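/- For $k\ge 0$ let $\mathcal P(k)$ be the set of noncrossing partitions of $\{1,\dots,k\}$ all of whose blocks have one or two elements (the partitions associated to the free bistochastic quantum group $B_n^+$). Write $|\pi|$ for the number of blocks of a partition and $\pi\vee\sigma$ for the supremum of $\pi,\sigma$ in the lattice of all partitions of $\{1,\dots,k\}$, and let $G_{kn}=(n^{|\pi\vee\sigma|})_{\pi,\sigma\in\mathcal P(k)}$ be the Gram matrix. Let $P_r$ be the Chebyshev polynomials given by $P_0(x)=1$, $P_1(x)=x$, $P_{r+1}(x)=xP_r(x)-P_{r-1}(x)$, and put $$a_k=\sum_{\pi\in\mathcal P(k)}(2|\pi|-k),\qquad f_{lr}=\binom{2l}{l-r}-\binom{2l}{l-r-1},\qquad d_{lr}=f_{lr}-f_{l,r+1},$$ where $\binom{m}{j}=0$ for $j<0$. Then $$\det(G_{kn})=n^{a_k}\prod_{r=1}^{[k/2]}P_r(n-1)^{\sum_{l=1}^{[k/2]}\binom{k}{2l}d_{lr}}$$ as an identity of rational functions in the indeterminate $n$ (some of the exponents of the factors $P_r(n-1)$ may be negative integers). The identity also holds at every real number $n$ such that $P_r(n-1)\neq 0$ for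 each $1\le r\le [k/2]$ whose exponent is negative. -/

import Mathlib

open Polynomial

namespace BistochasticGram

/-- Set partitions of the `k` points `Fin k` are encoded as equivalence relations.  The order
on `Setoid (Fin k)` is refinement (`π ≤ σ` iff each block of `π` lies in a block of `σ`), so
that `⊔` is the set-theoretic supremum of partitions.  This is the number `|π|` of blocks. -/
noncomputable def blockCount {k : ℕ} (π : Setoid (Fin k)) : ℕ :=
  π.classes.ncard

/-- A partition is noncrossing if there are no points `a < b < c < d` with `a, c` in one block
and `b, d` in another block. -/
def IsNoncrossing {k : ℕ} (π : Setoid (Fin k)) : Prop :=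
  ∀ a b c d : Fin k, a < b → b < c → c < d → π a c → π b d → π a b

/-- Every block is a singleton or a pair. -/
def HasSingletonsAndPairs {k : ℕ} (π : Setoid (Fin k)) : Prop :=
  ∀ B ∈ π.classes, B.ncard = 1 ∨ B.ncard = 2

/-- The diagrams of `B_n^+` on `k` points: noncrossing partitions into singletons and pairs. -/
def FreeBistochasticPartition (k : ℕ) : Type :=
  {π : Setoid (Fin k) // IsNoncrossing π ∧ HasSingletonsAndPairs π}

instance finite_setoid_fin (k : ℕ) : Finite (Setoid (Fin k)) :=
  Finite.of_injective (fun π : Setoid (Fin k) => fun a b : Fin k => π a b)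
    (fun _ _ h => Setoid.ext fun a b => iff_of_eq (congrFun (congrFun h a) b))

instance finite_freeBistochasticPartition (k : ℕ) : Finite (FreeBistochasticPartition k) :=
  inferInstanceAs (Finite {π : Setoid (Fin k) // IsNoncrossing π ∧ HasSingletonsAndPairs π})

noncomputable instance fintypeFreeBistochasticPartition (k : ℕ) :
    Fintype (FreeBistochasticPartition k) :=
  Fintype.ofFinite _

noncomputable instance decidableEqFreeBistochasticPartition (k : ℕ) :
    DecidableEq (FreeBistochasticPartition k) :=
  Classical.decEq _

/-- The Gram matrix `G_{kn}(π, σ) = n ^ |π ∨ σ|`, for a parameter `n` in any commutative ring.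
The supremum is taken among all partitions. -/
noncomputable def gramMatrix {R : Type*} [CommRing R] (k : ℕ) (n : R) :
    Matrix (FreeBistochasticPartition k) (FreeBistochasticPartition k) R :=
  Matrix.of fun π σ => n ^ blockCount (π.1 ⊔ σ.1)

/-- `a_k = ∑_π (2|π| - k)`. -/
noncomputable def aExp (k : ℕ) : ℤ :=
  ∑ π : FreeBistochasticPartition k, (2 * (blockCount π.1 : ℤ) - (k : ℤ))

/-- The value at `x` of the Chebyshev polynomial `P_r`, where `P_0 = 1`, `P_1 = X` and
`P_{r+1} = X P_r - P_{r-1}`; these are the polynomials `Polynomial.Chebyshev.S`. -/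
noncomputable def chebyshevP {R : Type*} [CommRing R] (r : ℕ) (x : R) : R :=
  (Chebyshev.S R (r : ℤ)).eval x

/-- The binomial coefficient with integer lower index, equal to `0` when that is negative. -/
def binom (m : ℕ) (j : ℤ) : ℤ :=
  if 0 ≤ j then (m.choose j.toNat : ℤ) else 0

/-- `f_{l,r} = binom(2l, l-r) - binom(2l, l-r-1)`. -/
def fNum (l r : ℕ) : ℤ :=
  binom (2 * l) ((l : ℤ) - (r : ℤ)) - binom (2 * l) ((l : ℤ) - (r : ℤ) - 1)

/-- `d_{l,r} = f_{l,r} - f_{l,r+1}`. -/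
def dNum (l r : ℕ) : ℤ :=
  fNum l r - fNum l (r + 1)

/-- The exponent `∑_{l=1}^{[k/2]} binom(k, 2l) d_{l,r}`, an integer that may be negative. -/
def chebExp (k r : ℕ) : ℤ :=
  ∑ l ∈ Finset.Icc 1 (k / 2), (k.choose (2 * l) : ℤ) * dNum l r

end BistochasticGram

set_option linter.unusedSectionVars false

namespace BistochasticGram

/-- A weighted graph with vertices `V` and edge labels `E`, on whose paths the diagrams with
pairs and singletons, with loop parameter `n`, act by inserting and contracting edges. -/
structure DiagramModel (K V E : Type) [CommRing K] [Fintype E] where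
  /-- the loop parameter -/
  n : K
  /-- the end of an edge -/
  act : V → E → V
  /-- the reversal of edges -/
  bar : E → E
  /-- the edges that exist at a vertex -/
  Ok : V → E → Prop
  /-- the weight of an inserted singleton -/
  s : V → E → K
  /-- the weight of an inserted pair -/
  c : V → E → K
  /-- the weight of an edge in the bilinear form -/
  d : V → E → K
  bar_bar : ∀ e, bar (bar e) = e
  act_bar : ∀ h e, Ok h e → act (act h e) (bar e) = h
  ok_bar : ∀ h e, Ok h e → Ok (act h e) (bar e)
  c_ok : ∀ h e, ¬ Ok h e → c h e = 0
  s_ok : ∀ h e, ¬ Ok h e → s h e = 0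
  s_act : ∀ h e, act h e ≠ h → s h e = 0
  loop : ∀ h, ∑ e, d h e * d (act h e) (bar e) * c h e * c h e = n
  zig : ∀ h e, Ok h e → d h e * d (act h e) (bar e) * c h e * c (act h e) (bar e) = 1
  s_loop : ∀ h, ∑ e, d h e * s h e * s h e = n
  s_left : ∀ h e, d h e * d (act h e) (bar e) * c h e * s h e = d h (bar e) * s h (bar e)
  s_right : ∀ h e, d h e * d (act h e) (bar e) * c h e * s (act h e) (bar e) = d h e * s h e
  c_left : ∀ h e, d h (bar e) * s h (bar e) * c h (bar e) = s h e
  c_right : ∀ h e, d (act h e) (bar e) * s (act h e) (bar e) * c h e = s h e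

/-- Insertion operations building a diagram from the empty one. -/
inductive Op
  | cap (i : ℕ)
  | single (i : ℕ)

/-- The number of points of the diagram built by a list of insertions. -/
def opsLength : List Op → ℕ
  | [] => 0
  | Op.cap _ :: w => opsLength w + 2
  | Op.single _ :: w => opsLength w + 1

/-- All the insertions take place within the diagram. -/
def OpsValid : List Op → Prop
  | [] => True
  | Op.cap i :: w => i ≤ opsLength w ∧ OpsValid w
  | Op.single i :: w => i ≤ opsLength w ∧ OpsValid w

namespace DiagramModel

variable {K V E : Type} [CommRing K] [Fintype E] [DecidableEq E] (M : DiagramModel K V E)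

/-- The weight of a contracted pair. -/
def w (h : V) (e : E) : K := M.d h e * M.d (M.act h e) (M.bar e) * M.c h e

/-- The weight of a contracted singleton. -/
def t (h : V) (e : E) : K := M.d h e * M.s h e

/-- Insertion of a pair at the positions `i, i + 1`. -/
def capAt : ℕ → V → (List E → K) → List E → K
  | 0, h, φ, e :: e' :: l => if e' = M.bar e then M.c h e * φ l else 0
  | 0, _, _, [_] => 0
  | 0, _, _, [] => 0
  | i + 1, h, φ, e :: l => capAt i (M.act h e) (fun l => φ (e :: l)) l
  | _ + 1, _, _, [] => 0

/-- Insertion of a singleton at the position `i`. -/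
def singleAt : ℕ → V → (List E → K) → List E → K
  | 0, h, φ, e :: l => M.s h e * φ l
  | 0, _, _, [] => 0
  | i + 1, h, φ, e :: l => singleAt i (M.act h e) (fun l => φ (e :: l)) l
  | _ + 1, _, _, [] => 0

/-- Contraction of the positions `i, i + 1` with a pair. -/
def cupAt : ℕ → V → (List E → K) → List E → K
  | 0, h, φ, l => ∑ e, M.w h e * φ (e :: M.bar e :: l)
  | i + 1, h, φ, e :: l => cupAt i (M.act h e) (fun l => φ (e :: l)) l
  | _ + 1, _, _, [] => 0

/-- Contraction of the position `i` with a singleton. -/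
def etaAt : ℕ → V → (List E → K) → List E → K
  | 0, h, φ, l => ∑ e, M.t h e * φ (e :: l)
  | i + 1, h, φ, e :: l => etaAt i (M.act h e) (fun l => φ (e :: l)) l
  | _ + 1, _, _, [] => 0

/-- The vector of a diagram, a function on paths starting at a vertex. -/
def vec : List Op → V → List E → K
  | [], _, l => if l = [] then 1 else 0
  | Op.cap i :: v, h, l => M.capAt i h (vec v h) l
  | Op.single i :: v, h, l => M.singleAt i h (vec v h) l

/-- Paths along existing edges. -/
def OkPath : V → List E → Prop
  | _, [] => True
  | h, e :: l => M.Ok h e ∧ OkPath (M.act h e) l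

/-- The function is supported on the paths of length `m` starting at `h`. -/
def Supp (h : V) (m : ℕ) (φ : List E → K) : Prop :=
  ∀ l, φ l ≠ 0 → l.length = m ∧ M.OkPath h l

/-- The bilinear form on functions on paths of length `m`. -/
def form : ℕ → V → (List E → K) → (List E → K) → K
  | 0, _, φ, ψ => φ [] * ψ []
  | m + 1, h, φ, ψ => ∑ e, M.d h e *
      form m (M.act h e) (fun l => φ (e :: l)) (fun l => ψ (e :: l))

variable {M}

theorem w_ok {h : V} {e : E} (he : ¬ M.Ok h e) : M.w h e = 0 := by
  simp [w, M.c_ok h e he]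

theorem t_act {h : V} {e : E} (he : M.act h e ≠ h) : M.t h e = 0 := by
  simp [t, M.s_act h e he]

theorem capAt_sum {ι : Type} (S : Finset ι) (i : ℕ) (h : V) (a : ι → K) (φ : ι → List E → K)
    (l : List E) : M.capAt i h (fun l => ∑ x ∈ S, a x * φ x l) l =
      ∑ x ∈ S, a x * M.capAt i h (φ x) l := by
  induction i generalizing h φ l with
  | zero =>
    rcases l with _ | ⟨e, _ | ⟨e', l⟩⟩
    · simp [capAt]
    · simp [capAt]
    · simp only [capAt]
      split_ifs
      · rw [Finset.mul_sum]; exact Finset.sum_congr rfl fun x _ => by ring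
      · simp
  | succ i ih =>
    rcases l with _ | ⟨e, l⟩
    · simp [capAt]
    · simp only [capAt]
      exact ih _ (fun x l => φ x (e :: l)) l

theorem singleAt_sum {ι : Type} (S : Finset ι) (i : ℕ) (h : V) (a : ι → K) (φ : ι → List E → K)
    (l : List E) : M.singleAt i h (fun l => ∑ x ∈ S, a x * φ x l) l =
      ∑ x ∈ S, a x * M.singleAt i h (φ x) l := by
  induction i generalizing h φ l with
  | zero =>
    rcases l with _ | ⟨e, l⟩
    · simp [singleAt]
    · simp only [singleAt]
      rw [Finset.mul_sum]; exact Finset.sum_congr rfl fun x _ => by ring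
  | succ i ih =>
    rcases l with _ | ⟨e, l⟩
    · simp [singleAt]
    · simp only [singleAt]
      exact ih _ (fun x l => φ x (e :: l)) l

theorem cupAt_mul (i : ℕ) (h : V) (a : K) (φ : List E → K) (l : List E) :
    M.cupAt i h (fun l => a * φ l) l = a * M.cupAt i h φ l := by
  induction i generalizing h φ l with
  | zero =>
    simp only [cupAt]
    rw [Finset.mul_sum]; exact Finset.sum_congr rfl fun x _ => by ring
  | succ i ih =>
    rcases l with _ | ⟨e, l⟩
    · simp [cupAt]
    · simp only [cupAt]
      exact ih _ (fun l => φ (e :: l)) l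

theorem etaAt_mul (i : ℕ) (h : V) (a : K) (φ : List E → K) (l : List E) :
    M.etaAt i h (fun l => a * φ l) l = a * M.etaAt i h φ l := by
  induction i generalizing h φ l with
  | zero =>
    simp only [etaAt]
    rw [Finset.mul_sum]; exact Finset.sum_congr rfl fun x _ => by ring
  | succ i ih =>
    rcases l with _ | ⟨e, l⟩
    · simp [etaAt]
    · simp only [etaAt]
      exact ih _ (fun l => φ (e :: l)) l

theorem capAt_mul (i : ℕ) (h : V) (a : K) (φ : List E → K) (l : List E) :
    M.capAt i h (fun l => a * φ l) l = a * M.capAt i h φ l := by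
  simpa using capAt_sum (M := M) ({()} : Finset Unit) i h (fun _ => a) (fun _ => φ) l

theorem singleAt_mul (i : ℕ) (h : V) (a : K) (φ : List E → K) (l : List E) :
    M.singleAt i h (fun l => a * φ l) l = a * M.singleAt i h φ l := by
  simpa using singleAt_sum (M := M) ({()} : Finset Unit) i h (fun _ => a) (fun _ => φ) l

/-! ### Commutation of distant operations -/

theorem cupAt_capAt_right (i d : ℕ) (h : V) (φ : List E → K) :
    M.cupAt i h (M.capAt (i + 2 + d) h φ) = M.capAt (i + d) h (M.cupAt i h φ) := by
  induction i generalizing h φ with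
  | zero =>
    funext l
    have e1 : 0 + 2 + d = d + 1 + 1 := by omega
    simp only [cupAt, e1, capAt, Nat.zero_add, capAt_sum]
    refine Finset.sum_congr rfl fun e _ => ?_
    by_cases he : M.Ok h e
    · rw [M.act_bar h e he]
    · simp [w_ok he]
  | succ i ih =>
    funext l
    have e1 : i + 1 + 2 + d = (i + 2 + d) + 1 := by omega
    have e2 : i + 1 + d = (i + d) + 1 := by omega
    rcases l with _ | ⟨e, l⟩
    · simp [cupAt, capAt, e2]
    · simp only [cupAt, capAt, e1, e2]
      exact congrFun (ih (M.act h e) _) l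

theorem cupAt_singleAt_right (i d : ℕ) (h : V) (φ : List E → K) :
    M.cupAt i h (M.singleAt (i + 2 + d) h φ) = M.singleAt (i + d) h (M.cupAt i h φ) := by
  induction i generalizing h φ with
  | zero =>
    funext l
    have e1 : 0 + 2 + d = d + 1 + 1 := by omega
    simp only [cupAt, e1, singleAt, Nat.zero_add, singleAt_sum]
    refine Finset.sum_congr rfl fun e _ => ?_
    by_cases he : M.Ok h e
    · rw [M.act_bar h e he]
    · simp [w_ok he]
  | succ i ih =>
    funext l
    have e1 : i + 1 + 2 + d = (i + 2 + d) + 1 := by omega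
    have e2 : i + 1 + d = (i + d) + 1 := by omega
    rcases l with _ | ⟨e, l⟩
    · simp [cupAt, singleAt, e2]
    · simp only [cupAt, singleAt, e1, e2]
      exact congrFun (ih (M.act h e) _) l

theorem etaAt_capAt_right (i d : ℕ) (h : V) (φ : List E → K) :
    M.etaAt i h (M.capAt (i + 1 + d) h φ) = M.capAt (i + d) h (M.etaAt i h φ) := by
  induction i generalizing h φ with
  | zero =>
    funext l
    have e1 : 0 + 1 + d = d + 1 := by omega
    simp only [etaAt, e1, capAt, Nat.zero_add, capAt_sum]
    refine Finset.sum_congr rfl fun e _ => ?_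
    by_cases he : M.act h e = h
    · rw [he]
    · simp [t_act he]
  | succ i ih =>
    funext l
    have e1 : i + 1 + 1 + d = (i + 1 + d) + 1 := by omega
    have e2 : i + 1 + d = (i + d) + 1 := by omega
    rcases l with _ | ⟨e, l⟩
    · simp [etaAt, capAt, e2]
    · simp only [etaAt, e1, capAt]
      rw [ih (M.act h e) _, e2, capAt]
      simp only [etaAt]

theorem etaAt_singleAt_right (i d : ℕ) (h : V) (φ : List E → K) :
    M.etaAt i h (M.singleAt (i + 1 + d) h φ) = M.singleAt (i + d) h (M.etaAt i h φ) := by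
  induction i generalizing h φ with
  | zero =>
    funext l
    have e1 : 0 + 1 + d = d + 1 := by omega
    simp only [etaAt, e1, singleAt, Nat.zero_add, singleAt_sum]
    refine Finset.sum_congr rfl fun e _ => ?_
    by_cases he : M.act h e = h
    · rw [he]
    · simp [t_act he]
  | succ i ih =>
    funext l
    have e1 : i + 1 + 1 + d = (i + 1 + d) + 1 := by omega
    have e2 : i + 1 + d = (i + d) + 1 := by omega
    rcases l with _ | ⟨e, l⟩
    · simp [etaAt, singleAt, e2]
    · simp only [etaAt, e1, singleAt]
      rw [ih (M.act h e) _, e2, singleAt]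
      simp only [etaAt]

theorem cupAt_capAt_left (j d : ℕ) (h : V) (φ : List E → K) :
    M.cupAt (j + 2 + d) h (M.capAt j h φ) = M.capAt j h (M.cupAt (j + d) h φ) := by
  induction j generalizing h φ with
  | zero =>
    funext l
    have e1 : 0 + 2 + d = d + 1 + 1 := by omega
    rw [e1, Nat.zero_add]
    rcases l with _ | ⟨e, _ | ⟨e', l⟩⟩
    · simp [cupAt, capAt]
    · simp [cupAt, capAt]
    · simp only [cupAt, capAt]
      split_ifs with hb
      · rw [cupAt_mul]
        by_cases he : M.Ok h e
        · rw [hb, M.act_bar h e he]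
        · simp [M.c_ok h e he]
      · simpa using cupAt_mul (M := M) d (M.act (M.act h e) e') 0 (fun _ => 0) l
  | succ j ih =>
    funext l
    have e1 : j + 1 + 2 + d = (j + 2 + d) + 1 := by omega
    have e2 : j + 1 + d = (j + d) + 1 := by omega
    rw [e1, e2]
    rcases l with _ | ⟨e, l⟩
    · simp [cupAt, capAt]
    · simp only [cupAt, capAt]
      rw [ih]

theorem etaAt_capAt_left (j d : ℕ) (h : V) (φ : List E → K) :
    M.etaAt (j + 2 + d) h (M.capAt j h φ) = M.capAt j h (M.etaAt (j + d) h φ) := by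
  induction j generalizing h φ with
  | zero =>
    funext l
    have e1 : 0 + 2 + d = d + 1 + 1 := by omega
    rw [e1, Nat.zero_add]
    rcases l with _ | ⟨e, _ | ⟨e', l⟩⟩
    · simp [etaAt, capAt]
    · simp [etaAt, capAt]
    · simp only [etaAt, capAt]
      split_ifs with hb
      · rw [etaAt_mul]
        by_cases he : M.Ok h e
        · rw [hb, M.act_bar h e he]
        · simp [M.c_ok h e he]
      · simpa using etaAt_mul (M := M) d (M.act (M.act h e) e') 0 (fun _ => 0) l
  | succ j ih =>
    funext l
    have e1 : j + 1 + 2 + d = (j + 2 + d) + 1 := by omega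
    have e2 : j + 1 + d = (j + d) + 1 := by omega
    rw [e1, e2]
    rcases l with _ | ⟨e, l⟩
    · simp [etaAt, capAt]
    · simp only [etaAt, capAt]
      rw [ih]

theorem cupAt_singleAt_left (j d : ℕ) (h : V) (φ : List E → K) :
    M.cupAt (j + 1 + d) h (M.singleAt j h φ) = M.singleAt j h (M.cupAt (j + d) h φ) := by
  induction j generalizing h φ with
  | zero =>
    funext l
    have e1 : 0 + 1 + d = d + 1 := by omega
    rw [e1, Nat.zero_add]
    rcases l with _ | ⟨e, l⟩
    · simp [cupAt, singleAt]
    · simp only [cupAt, singleAt]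
      rw [cupAt_mul]
      by_cases he : M.act h e = h
      · rw [he]
      · simp [M.s_act h e he]
  | succ j ih =>
    funext l
    have e1 : j + 1 + 1 + d = (j + 1 + d) + 1 := by omega
    have e2 : j + 1 + d = (j + d) + 1 := by omega
    rw [e1]
    rcases l with _ | ⟨e, l⟩
    · simp [cupAt, singleAt]
    · simp only [cupAt, singleAt]
      rw [ih, e2]
      simp only [cupAt]

theorem etaAt_singleAt_left (j d : ℕ) (h : V) (φ : List E → K) :
    M.etaAt (j + 1 + d) h (M.singleAt j h φ) = M.singleAt j h (M.etaAt (j + d) h φ) := by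
  induction j generalizing h φ with
  | zero =>
    funext l
    have e1 : 0 + 1 + d = d + 1 := by omega
    rw [e1, Nat.zero_add]
    rcases l with _ | ⟨e, l⟩
    · simp [etaAt, singleAt]
    · simp only [etaAt, singleAt]
      rw [etaAt_mul]
      by_cases he : M.act h e = h
      · rw [he]
      · simp [M.s_act h e he]
  | succ j ih =>
    funext l
    have e1 : j + 1 + 1 + d = (j + 1 + d) + 1 := by omega
    have e2 : j + 1 + d = (j + d) + 1 := by omega
    rw [e1]
    rcases l with _ | ⟨e, l⟩
    · simp [etaAt, singleAt]
    · simp only [etaAt, singleAt]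
      rw [ih, e2]
      simp only [etaAt]

/-! ### Interaction of adjacent operations -/

theorem cupAt_capAt_self (i : ℕ) (h : V) (m : ℕ) (him : i ≤ m) (φ : List E → K)
    (hφ : M.Supp h m φ) : M.cupAt i h (M.capAt i h φ) = fun l => M.n * φ l := by
  induction i generalizing h m φ with
  | zero =>
    funext l
    simp only [cupAt, capAt, if_true, ← M.loop h, Finset.sum_mul, w]
    exact Finset.sum_congr rfl fun e _ => by ring
  | succ i ih =>
    funext l
    rcases l with _ | ⟨e, l⟩
    · have : φ [] = 0 := by
        by_contra hne
        have := (hφ _ hne).1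
        simp at this; omega
      simp [cupAt, this]
    · simp only [cupAt, capAt]
      obtain ⟨m, rfl⟩ : ∃ m', m = m' + 1 := ⟨m - 1, by omega⟩
      rw [ih (M.act h e) m (by omega) _ fun l hl => ?_]
      have := hφ _ hl
      exact ⟨by simpa using this.1, this.2.2⟩

theorem cupAt_capAt_succ (i : ℕ) (h : V) (m : ℕ) (him : i < m) (φ : List E → K)
    (hφ : M.Supp h m φ) : M.cupAt i h (M.capAt (i + 1) h φ) = φ := by
  induction i generalizing h m φ with
  | zero =>
    funext l
    rcases l with _ | ⟨e, l⟩
    · have : φ [] = 0 := by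
        by_contra hne
        have := (hφ _ hne).1
        simp at this; omega
      simp [cupAt, capAt, this]
    · simp only [cupAt, capAt, M.bar_bar]
      rw [Finset.sum_eq_single e]
      · by_cases he : M.Ok h e
        · have := M.zig h e he
          simp only [if_true, w]
          rw [← mul_assoc, this, one_mul]
        · have : φ (e :: l) = 0 := by
            by_contra hne
            exact he (hφ _ hne).2.1
          simp [this]
      · intro b _ hb
        rw [if_neg (Ne.symm hb), mul_zero]
      · simp
  | succ i ih =>
    funext l
    rcases l with _ | ⟨e, l⟩
    · have : φ [] = 0 := by
        by_contra hne
        have := (hφ _ hne).1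
        simp at this; omega
      simp [cupAt, this]
    · simp only [cupAt, capAt]
      obtain ⟨m, rfl⟩ : ∃ m', m = m' + 1 := ⟨m - 1, by omega⟩
      rw [ih (M.act h e) m (by omega) _ fun l hl => ?_]
      have := hφ _ hl
      exact ⟨by simpa using this.1, this.2.2⟩

theorem cupAt_succ_capAt (i : ℕ) (h : V) (m : ℕ) (him : i < m) (φ : List E → K)
    (hφ : M.Supp h m φ) : M.cupAt (i + 1) h (M.capAt i h φ) = φ := by
  induction i generalizing h m φ with
  | zero =>
    funext l
    rcases l with _ | ⟨e, l⟩
    · have : φ [] = 0 := by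
        by_contra hne
        have := (hφ _ hne).1
        simp at this; omega
      simp [cupAt, this]
    · simp only [cupAt, capAt]
      rw [Finset.sum_eq_single (M.bar e)]
      · by_cases he : M.Ok h e
        · have := M.zig _ _ (M.ok_bar h e he)
          rw [M.act_bar h e he, M.bar_bar] at this
          simp only [if_true, w, M.act_bar h e he, M.bar_bar]
          rw [← mul_assoc, this, one_mul]
        · have : φ (e :: l) = 0 := by
            by_contra hne
            exact he (hφ _ hne).2.1
          simp [this, M.bar_bar]
      · intro b _ hb
        rw [if_neg hb, mul_zero]
      · simp
  | succ i ih =>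
    funext l
    rcases l with _ | ⟨e, l⟩
    · have : φ [] = 0 := by
        by_contra hne
        have := (hφ _ hne).1
        simp at this; omega
      simp [cupAt, this]
    · rw [cupAt]
      simp only [capAt]
      obtain ⟨m, rfl⟩ : ∃ m', m = m' + 1 := ⟨m - 1, by omega⟩
      rw [ih (M.act h e) m (by omega) _ fun l hl => ?_]
      have := hφ _ hl
      exact ⟨by simpa using this.1, this.2.2⟩

theorem etaAt_singleAt_self (i : ℕ) (h : V) (m : ℕ) (him : i ≤ m) (φ : List E → K)
    (hφ : M.Supp h m φ) : M.etaAt i h (M.singleAt i h φ) = fun l => M.n * φ l := by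
  induction i generalizing h m φ with
  | zero =>
    funext l
    simp only [etaAt, singleAt, ← M.s_loop h, Finset.sum_mul, t]
    exact Finset.sum_congr rfl fun e _ => by ring
  | succ i ih =>
    funext l
    rcases l with _ | ⟨e, l⟩
    · have : φ [] = 0 := by
        by_contra hne
        have := (hφ _ hne).1
        simp at this; omega
      simp [etaAt, this]
    · simp only [etaAt, singleAt]
      obtain ⟨m, rfl⟩ : ∃ m', m = m' + 1 := ⟨m - 1, by omega⟩
      rw [ih (M.act h e) m (by omega) _ fun l hl => ?_]
      have := hφ _ hl
      exact ⟨by simpa using this.1, this.2.2⟩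

theorem cupAt_singleAt_self (i : ℕ) (h : V) (φ : List E → K) :
    M.cupAt i h (M.singleAt i h φ) = M.etaAt i h φ := by
  induction i generalizing h φ with
  | zero =>
    funext l
    simp only [cupAt, singleAt, etaAt]
    have hinv : Function.Involutive M.bar := M.bar_bar
    rw [← Equiv.sum_comp hinv.toPerm (fun e => M.t h e * φ (e :: l))]
    refine Finset.sum_congr rfl fun e _ => ?_
    simp only [Function.Involutive.coe_toPerm, t, w]
    rw [← M.s_left h e]; ring
  | succ i ih =>
    funext l
    rcases l with _ | ⟨e, l⟩
    · simp [cupAt, etaAt]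
    · simp only [cupAt, singleAt, etaAt]
      rw [ih]

theorem cupAt_singleAt_succ (i : ℕ) (h : V) (φ : List E → K) :
    M.cupAt i h (M.singleAt (i + 1) h φ) = M.etaAt i h φ := by
  induction i generalizing h φ with
  | zero =>
    funext l
    simp only [cupAt, singleAt, etaAt]
    refine Finset.sum_congr rfl fun e _ => ?_
    simp only [t, w]
    rw [← M.s_right h e]; ring
  | succ i ih =>
    funext l
    rcases l with _ | ⟨e, l⟩
    · simp [cupAt, etaAt]
    · rw [cupAt, etaAt, ← ih]
      simp only [singleAt]

theorem etaAt_capAt_self (i : ℕ) (h : V) (φ : List E → K) :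
    M.etaAt i h (M.capAt i h φ) = M.singleAt i h φ := by
  induction i generalizing h φ with
  | zero =>
    funext l
    rcases l with _ | ⟨e, l⟩
    · simp [etaAt, capAt, singleAt]
    · simp only [etaAt, capAt, singleAt]
      rw [Finset.sum_eq_single (M.bar e), M.bar_bar, if_pos rfl, ← M.c_left h e, t]
      · ring
      · intro b _ hb
        rw [if_neg, mul_zero]
        rintro rfl
        exact hb (M.bar_bar b).symm
      · simp
  | succ i ih =>
    funext l
    rcases l with _ | ⟨e, l⟩
    · simp [etaAt, singleAt]
    · simp only [etaAt, capAt, singleAt]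
      rw [ih]

theorem etaAt_succ_capAt (i : ℕ) (h : V) (φ : List E → K) :
    M.etaAt (i + 1) h (M.capAt i h φ) = M.singleAt i h φ := by
  induction i generalizing h φ with
  | zero =>
    funext l
    rcases l with _ | ⟨e, l⟩
    · simp [etaAt, singleAt]
    · simp only [etaAt, capAt, singleAt]
      rw [Finset.sum_eq_single (M.bar e), if_pos rfl, ← M.c_right h e, t]
      · ring
      · intro b _ hb
        rw [if_neg hb, mul_zero]
      · simp
  | succ i ih =>
    funext l
    rcases l with _ | ⟨e, l⟩
    · simp [etaAt, singleAt]
    · rw [etaAt, singleAt, ← ih]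
      simp only [capAt]

/-! ### Supports -/

theorem supp_cons {h : V} {m : ℕ} {φ : List E → K} (hφ : M.Supp h (m + 1) φ) (e : E) :
    M.Supp (M.act h e) m (fun l => φ (e :: l)) := fun l hl => by
  have := hφ _ hl
  exact ⟨by simpa using this.1, this.2.2⟩

theorem supp_capAt {i : ℕ} {h : V} {m : ℕ} {φ : List E → K} (him : i ≤ m)
    (hφ : M.Supp h m φ) : M.Supp h (m + 2) (M.capAt i h φ) := by
  induction i generalizing h m φ with
  | zero =>
    intro l hl
    rcases l with _ | ⟨e, _ | ⟨e', l⟩⟩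
    · simp [capAt] at hl
    · simp [capAt] at hl
    · simp only [capAt, ne_eq, ite_eq_right_iff, not_forall] at hl
      obtain ⟨rfl, hl⟩ := hl
      have h1 := hφ l fun h0 => hl (by rw [h0, mul_zero])
      have he : M.Ok h e := by
        by_contra he
        exact hl (by rw [M.c_ok h e he, zero_mul])
      refine ⟨by simp [h1.1], he, M.ok_bar h e he, ?_⟩
      rw [M.act_bar h e he]
      exact h1.2
  | succ i ih =>
    intro l hl
    rcases l with _ | ⟨e, l⟩
    · simp [capAt] at hl
    · obtain ⟨m, rfl⟩ : ∃ m', m = m' + 1 := ⟨m - 1, by omega⟩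
      simp only [capAt] at hl
      have h1 := ih (h := M.act h e) (m := m) (by omega) (supp_cons hφ e) l hl
      refine ⟨by simp [h1.1], ?_, h1.2⟩
      by_contra he
      have hz : (fun l => φ (e :: l)) = fun l => (0 : K) * φ (e :: l) := by
        funext l
        rw [zero_mul]
        by_contra hne
        exact he (hφ _ hne).2.1
      rw [hz, capAt_mul, zero_mul] at hl
      exact hl rfl

theorem supp_singleAt {i : ℕ} {h : V} {m : ℕ} {φ : List E → K} (him : i ≤ m)
    (hφ : M.Supp h m φ) : M.Supp h (m + 1) (M.singleAt i h φ) := by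
  induction i generalizing h m φ with
  | zero =>
    intro l hl
    rcases l with _ | ⟨e, l⟩
    · simp [singleAt] at hl
    · simp only [singleAt] at hl
      have h1 := hφ l fun h0 => hl (by rw [h0, mul_zero])
      have he : M.Ok h e := by
        by_contra he
        exact hl (by rw [M.s_ok h e he, zero_mul])
      have ha : M.act h e = h := by
        by_contra he
        exact hl (by rw [M.s_act h e he, zero_mul])
      refine ⟨by simp [h1.1], he, ?_⟩
      rw [ha]
      exact h1.2
  | succ i ih =>
    intro l hl
    rcases l with _ | ⟨e, l⟩
    · simp [singleAt] at hl
    · obtain ⟨m, rfl⟩ : ∃ m', m = m' + 1 := ⟨m - 1, by omega⟩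
      simp only [singleAt] at hl
      have h1 := ih (h := M.act h e) (m := m) (by omega) (supp_cons hφ e) l hl
      refine ⟨by simp [h1.1], ?_, h1.2⟩
      by_contra he
      have hz : (fun l => φ (e :: l)) = fun l => (0 : K) * φ (e :: l) := by
        funext l
        rw [zero_mul]
        by_contra hne
        exact he (hφ _ hne).2.1
      rw [hz, singleAt_mul, zero_mul] at hl
      exact hl rfl

theorem supp_vec {v : List Op} (hv : OpsValid v) (h : V) :
    M.Supp h (opsLength v) (M.vec v h) := by
  induction v with
  | nil =>
    intro l hl
    by_cases h0 : l = []
    · subst h0; simp [opsLength, OkPath]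
    · simp [vec, h0] at hl
  | cons o v ih =>
    cases o with
    | cap i => exact supp_capAt hv.1 (ih hv.2)
    | single i => exact supp_singleAt hv.1 (ih hv.2)

/-! ### Contraction of diagrams -/

variable (M) in
theorem vec_cap (i : ℕ) (v : List Op) (h : V) :
    M.vec (Op.cap i :: v) h = M.capAt i h (M.vec v h) := rfl

variable (M) in
theorem vec_single (i : ℕ) (v : List Op) (h : V) :
    M.vec (Op.single i :: v) h = M.singleAt i h (M.vec v h) := rfl

end DiagramModel

open DiagramModel

theorem exists_etaAt_vec {v : List Op} (hv : OpsValid v) (i : ℕ) (hi : i + 1 ≤ opsLength v) :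
    ∃ (e : ℕ) (v' : List Op), OpsValid v' ∧ opsLength v' + 1 = opsLength v ∧
      ∀ {K V E : Type} [CommRing K] [Fintype E] [DecidableEq E] (M : DiagramModel K V E) (h : V),
        M.etaAt i h (M.vec v h) = fun l => M.n ^ e * M.vec v' h l := by
  induction v generalizing i with
  | nil => simp [opsLength] at hi
  | cons o v ih =>
    cases o with
    | cap j =>
      obtain ⟨hj, hv⟩ := hv
      simp only [opsLength] at hi ⊢
      rcases lt_trichotomy i j with hij | rfl | hij
      · obtain ⟨e, v', hv', hl, hM⟩ := ih hv i (by omega)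
        obtain ⟨d, rfl⟩ : ∃ d, j = i + 1 + d := ⟨j - i - 1, by omega⟩
        refine ⟨e, Op.cap (i + d) :: v', ⟨by omega, hv'⟩, by simp only [opsLength]; omega, ?_⟩
        intro K V E _ _ _ M h
        funext l
        rw [vec_cap, etaAt_capAt_right, hM, capAt_mul, vec_cap]
      · refine ⟨0, Op.single i :: v, ⟨hj, hv⟩, by simp only [opsLength], ?_⟩
        intro K V E _ _ _ M h
        funext l
        rw [vec_cap, etaAt_capAt_self, vec_single, pow_zero, one_mul]
      · rcases Nat.eq_or_lt_of_le (Nat.succ_le_of_lt hij) with h1 | h1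
        · obtain rfl : i = j + 1 := by omega
          refine ⟨0, Op.single j :: v, ⟨hj, hv⟩, by simp only [opsLength], ?_⟩
          intro K V E _ _ _ M h
          funext l
          rw [vec_cap, etaAt_succ_capAt, vec_single, pow_zero, one_mul]
        · obtain ⟨d, rfl⟩ : ∃ d, i = j + 2 + d := ⟨i - j - 2, by omega⟩
          obtain ⟨e, v', hv', hl, hM⟩ := ih hv (j + d) (by omega)
          refine ⟨e, Op.cap j :: v', ⟨by omega, hv'⟩, by simp only [opsLength]; omega, ?_⟩
          intro K V E _ _ _ M h
          funext l
          rw [vec_cap, etaAt_capAt_left, hM, capAt_mul, vec_cap]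
    | single j =>
      obtain ⟨hj, hv⟩ := hv
      simp only [opsLength] at hi ⊢
      rcases lt_trichotomy i j with hij | rfl | hij
      · obtain ⟨e, v', hv', hl, hM⟩ := ih hv i (by omega)
        obtain ⟨d, rfl⟩ : ∃ d, j = i + 1 + d := ⟨j - i - 1, by omega⟩
        refine ⟨e, Op.single (i + d) :: v', ⟨by omega, hv'⟩, by simp only [opsLength]; omega, ?_⟩
        intro K V E _ _ _ M h
        funext l
        rw [vec_single, etaAt_singleAt_right, hM, singleAt_mul, vec_single]
      · refine ⟨1, v, hv, rfl, ?_⟩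
        intro K V E _ _ _ M h
        rw [vec_single, etaAt_singleAt_self i h _ hj _ (supp_vec hv h), pow_one]
      · obtain ⟨d, rfl⟩ : ∃ d, i = j + 1 + d := ⟨i - j - 1, by omega⟩
        obtain ⟨e, v', hv', hl, hM⟩ := ih hv (j + d) (by omega)
        refine ⟨e, Op.single j :: v', ⟨by omega, hv'⟩, by simp only [opsLength]; omega, ?_⟩
        intro K V E _ _ _ M h
        funext l
        rw [vec_single, etaAt_singleAt_left, hM, singleAt_mul, vec_single]

theorem exists_cupAt_vec {v : List Op} (hv : OpsValid v) (i : ℕ) (hi : i + 2 ≤ opsLength v) :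
    ∃ (e : ℕ) (v' : List Op), OpsValid v' ∧ opsLength v' + 2 = opsLength v ∧
      ∀ {K V E : Type} [CommRing K] [Fintype E] [DecidableEq E] (M : DiagramModel K V E) (h : V),
        M.cupAt i h (M.vec v h) = fun l => M.n ^ e * M.vec v' h l := by
  induction v generalizing i with
  | nil => simp [opsLength] at hi
  | cons o v ih =>
    cases o with
    | cap j =>
      obtain ⟨hj, hv⟩ := hv
      simp only [opsLength] at hi ⊢
      obtain h1 | rfl | rfl | rfl | h1 :
        i + 2 ≤ j ∨ j = i + 1 ∨ i = j ∨ i = j + 1 ∨ j + 2 ≤ i := by omega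
      · obtain ⟨e, v', hv', hl, hM⟩ := ih hv i (by omega)
        obtain ⟨d, rfl⟩ : ∃ d, j = i + 2 + d := ⟨j - i - 2, by omega⟩
        refine ⟨e, Op.cap (i + d) :: v', ⟨by omega, hv'⟩, by simp only [opsLength]; omega, ?_⟩
        intro K V E _ _ _ M h
        funext l
        rw [vec_cap, cupAt_capAt_right, hM, capAt_mul, vec_cap]
      · refine ⟨0, v, hv, rfl, ?_⟩
        intro K V E _ _ _ M h
        rw [vec_cap, cupAt_capAt_succ i h _ (by omega) _ (supp_vec hv h)]
        simp
      · refine ⟨1, v, hv, rfl, ?_⟩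
        intro K V E _ _ _ M h
        rw [vec_cap, cupAt_capAt_self i h _ (by omega) _ (supp_vec hv h), pow_one]
      · refine ⟨0, v, hv, rfl, ?_⟩
        intro K V E _ _ _ M h
        rw [vec_cap, cupAt_succ_capAt j h _ (by omega) _ (supp_vec hv h)]
        simp
      · obtain ⟨d, rfl⟩ : ∃ d, i = j + 2 + d := ⟨i - j - 2, by omega⟩
        obtain ⟨e, v', hv', hl, hM⟩ := ih hv (j + d) (by omega)
        refine ⟨e, Op.cap j :: v', ⟨by omega, hv'⟩, by simp only [opsLength]; omega, ?_⟩
        intro K V E _ _ _ M h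
        funext l
        rw [vec_cap, cupAt_capAt_left, hM, capAt_mul, vec_cap]
    | single j =>
      obtain ⟨hj, hv⟩ := hv
      simp only [opsLength] at hi ⊢
      obtain h1 | rfl | rfl | h1 : i + 2 ≤ j ∨ j = i + 1 ∨ i = j ∨ j + 1 ≤ i := by omega
      · obtain ⟨e, v', hv', hl, hM⟩ := ih hv i (by omega)
        obtain ⟨d, rfl⟩ : ∃ d, j = i + 2 + d := ⟨j - i - 2, by omega⟩
        refine ⟨e, Op.single (i + d) :: v', ⟨by omega, hv'⟩, by simp only [opsLength]; omega, ?_⟩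
        intro K V E _ _ _ M h
        funext l
        rw [vec_single, cupAt_singleAt_right, hM, singleAt_mul, vec_single]
      · obtain ⟨e, v', hv', hl, hM⟩ := exists_etaAt_vec hv i (by omega)
        refine ⟨e, v', hv', by omega, ?_⟩
        intro K V E _ _ _ M h
        rw [vec_single, cupAt_singleAt_succ, hM]
      · obtain ⟨e, v', hv', hl, hM⟩ := exists_etaAt_vec hv i (by omega)
        refine ⟨e, v', hv', by omega, ?_⟩
        intro K V E _ _ _ M h
        rw [vec_single, cupAt_singleAt_self, hM]
      · obtain ⟨d, rfl⟩ : ∃ d, i = j + 1 + d := ⟨i - j - 1, by omega⟩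
        obtain ⟨e, v', hv', hl, hM⟩ := ih hv (j + d) (by omega)
        refine ⟨e, Op.single j :: v', ⟨by omega, hv'⟩, by simp only [opsLength]; omega, ?_⟩
        intro K V E _ _ _ M h
        funext l
        rw [vec_single, cupAt_singleAt_left, hM, singleAt_mul, vec_single]

namespace DiagramModel

variable {K V E : Type} [CommRing K] [Fintype E] [DecidableEq E] {M : DiagramModel K V E}

theorem form_sum_left {ι : Type} (S : Finset ι) (m : ℕ) (h : V) (a : ι → K)
    (φ : ι → List E → K) (ψ : List E → K) :
    M.form m h (fun l => ∑ x ∈ S, a x * φ x l) ψ = ∑ x ∈ S, a x * M.form m h (φ x) ψ := by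
  induction m generalizing h φ ψ with
  | zero =>
    simp only [form, Finset.sum_mul]
    exact Finset.sum_congr rfl fun x _ => by ring
  | succ m ih =>
    simp only [form]
    simp only [ih _ (fun x l => φ x (_ :: l)), Finset.mul_sum]
    rw [Finset.sum_comm]
    exact Finset.sum_congr rfl fun x _ => Finset.sum_congr rfl fun e _ => by ring

theorem form_mul_left (m : ℕ) (h : V) (a : K) (φ ψ : List E → K) :
    M.form m h (fun l => a * φ l) ψ = a * M.form m h φ ψ := by
  simpa using form_sum_left (M := M) ({()} : Finset Unit) m h (fun _ => a) (fun _ => φ) ψ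

theorem form_mul_right (m : ℕ) (h : V) (a : K) (φ ψ : List E → K) :
    M.form m h φ (fun l => a * ψ l) = a * M.form m h φ ψ := by
  induction m generalizing h φ ψ with
  | zero => simp only [form]; ring
  | succ m ih =>
    simp only [form, ih _ _ (fun l => ψ (_ :: l)), Finset.mul_sum]
    exact Finset.sum_congr rfl fun e _ => by ring

theorem form_capAt (m i : ℕ) (him : i ≤ m) (h : V) (φ ψ : List E → K) :
    M.form (m + 2) h φ (M.capAt i h ψ) = M.form m h (M.cupAt i h φ) ψ := by
  induction i generalizing m h φ ψ with
  | zero =>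
    change _ = M.form m h (fun l => ∑ e, M.w h e * φ (e :: M.bar e :: l)) ψ
    rw [form_sum_left (φ := fun e l => φ (e :: M.bar e :: l))]
    simp only [form, capAt]
    refine Finset.sum_congr rfl fun e _ => ?_
    rw [Finset.sum_eq_single (M.bar e)]
    · simp only [if_true]
      rw [form_mul_right]
      by_cases he : M.Ok h e
      · rw [M.act_bar h e he, w]; ring
      · rw [w_ok he, M.c_ok h e he]; ring
    · intro b _ hb
      simp only [if_neg hb]
      have := form_mul_right (M := M) m (M.act (M.act h e) b) 0 (fun l => φ (e :: b :: l))
        (fun _ => 0)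
      simp only [zero_mul] at this
      rw [this, mul_zero]
    · simp
  | succ i ih =>
    obtain ⟨m, rfl⟩ : ∃ m', m = m' + 1 := ⟨m - 1, by omega⟩
    rw [form, show m + 1 + 1 = m + 2 from rfl, form]
    refine Finset.sum_congr rfl fun e _ => ?_
    simp only [capAt, cupAt]
    rw [ih m (by omega)]

theorem form_singleAt (m i : ℕ) (him : i ≤ m) (h : V) (φ ψ : List E → K) :
    M.form (m + 1) h φ (M.singleAt i h ψ) = M.form m h (M.etaAt i h φ) ψ := by
  induction i generalizing m h φ ψ with
  | zero =>
    change _ = M.form m h (fun l => ∑ e, M.t h e * φ (e :: l)) ψ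
    rw [form_sum_left (φ := fun e l => φ (e :: l))]
    simp only [form, singleAt]
    refine Finset.sum_congr rfl fun e _ => ?_
    rw [form_mul_right]
    by_cases he : M.act h e = h
    · rw [he, t]; ring
    · rw [t_act he, M.s_act h e he]; ring
  | succ i ih =>
    obtain ⟨m, rfl⟩ : ∃ m', m = m' + 1 := ⟨m - 1, by omega⟩
    rw [form, form]
    refine Finset.sum_congr rfl fun e _ => ?_
    simp only [singleAt, etaAt]
    rw [ih m (by omega)]

end DiagramModel

/-- The pairing of two diagrams is a power of the loop parameter, with the same exponent in all
models. -/
theorem exists_form_vec {v u : List Op} (hv : OpsValid v) (hu : OpsValid u)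
    (huv : opsLength v = opsLength u) :
    ∃ e : ℕ, ∀ {K V E : Type} [CommRing K] [Fintype E] [DecidableEq E]
      (M : DiagramModel K V E) (h : V),
        M.form (opsLength u) h (M.vec v h) (M.vec u h) = M.n ^ e := by
  induction u generalizing v with
  | nil =>
    rcases v with _ | ⟨_ | _, v⟩
    · exact ⟨0, fun M h => by simp [opsLength, form, vec]⟩
    · simp [opsLength] at huv
    · simp [opsLength] at huv
  | cons o u ih =>
    cases o with
    | cap i =>
      obtain ⟨hi, hu⟩ := hu
      simp only [opsLength] at huv ⊢
      obtain ⟨e, v', hv', hl, hM⟩ := exists_cupAt_vec hv i (by omega)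
      obtain ⟨e', he'⟩ := ih hv' hu (by omega)
      refine ⟨e + e', ?_⟩
      intro K V E _ _ _ M h
      rw [vec_cap, form_capAt _ _ hi, hM, form_mul_left, he', pow_add]
    | single i =>
      obtain ⟨hi, hu⟩ := hu
      simp only [opsLength] at huv ⊢
      obtain ⟨e, v', hv', hl, hM⟩ := exists_etaAt_vec hv i (by omega)
      obtain ⟨e', he'⟩ := ih hv' hu (by omega)
      refine ⟨e + e', ?_⟩
      intro K V E _ _ _ M h
      rw [vec_single, form_singleAt _ _ hi, hM, form_mul_left, he', pow_add]

/-! ### Diagrams as relations on natural numbers -/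

/-- A relation on `{0, …, k - 1}` that is the equivalence relation of a noncrossing partition into
singletons and pairs. -/
structure IsDiag (k : ℕ) (R : ℕ → ℕ → Prop) : Prop where
  lt : ∀ a b, R a b → a < k
  refl : ∀ a, a < k → R a a
  symm : ∀ a b, R a b → R b a
  uniq : ∀ a b c, R a b → R a c → a ≠ b → a ≠ c → b = c
  nc : ∀ a b c d, a < b → b < c → c < d → R a c → R b d → False

theorem IsDiag.lt_right {k : ℕ} {R : ℕ → ℕ → Prop} (hR : IsDiag k R) {a b : ℕ} (h : R a b) :
    b < k := hR.lt b a (hR.symm a b h)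

open Classical in
/-- The Motzkin step at a point: up (`2`) for the left end of a pair, down (`0`) for the right end,
flat (`1`) for a singleton. -/
noncomputable def step (R : ℕ → ℕ → Prop) (a : ℕ) : Fin 3 :=
  if ∃ b, a < b ∧ R a b then 2 else if ∃ b, b < a ∧ R a b then 0 else 1

/-- The Motzkin path of a diagram. -/
noncomputable def path (k : ℕ) (R : ℕ → ℕ → Prop) : List (Fin 3) :=
  (List.range k).map (step R)

/-- The embedding of `ℕ` into itself that skips the interval `[i, i + d)`. -/
def skip (i d a : ℕ) : ℕ := if a < i then a else a + d

theorem skip_lt_iff (i d a b : ℕ) : skip i d a < skip i d b ↔ a < b := by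
  unfold skip; split_ifs <;> omega

theorem skip_inj {i d a b : ℕ} (h : skip i d a = skip i d b) : a = b := by
  unfold skip at h; split_ifs at h <;> omega

theorem exists_skip {i d b : ℕ} (h : ¬ (i ≤ b ∧ b < i + d)) : ∃ a, skip i d a = b := by
  by_cases hb : b < i
  · exact ⟨b, if_pos hb⟩
  · exact ⟨b - d, by unfold skip; split_ifs <;> omega⟩

theorem skip_not_mem (i d a : ℕ) : ¬ (i ≤ skip i d a ∧ skip i d a < i + d) := by
  unfold skip; split_ifs <;> omega

/-- The relation with the points of the interval `[i, i + d)` deleted. -/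
def deleted (i d : ℕ) (R : ℕ → ℕ → Prop) (a b : ℕ) : Prop := R (skip i d a) (skip i d b)

theorem IsDiag.deleted {k i d : ℕ} {R : ℕ → ℕ → Prop} (hR : IsDiag (k + d) R) (hi : i ≤ k) :
    IsDiag k (deleted i d R) where
  lt a b h := by
    have := hR.lt _ _ h
    unfold skip at this; split_ifs at this <;> omega
  refl a h := hR.refl _ (by unfold skip; split_ifs <;> omega)
  symm a b h := hR.symm _ _ h
  uniq a b c h1 h2 h3 h4 :=
    skip_inj (hR.uniq _ _ _ h1 h2 (fun h => h3 (skip_inj h)) (fun h => h4 (skip_inj h)))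
  nc a b c d' h1 h2 h3 h4 h5 :=
    hR.nc _ _ _ _ ((skip_lt_iff ..).2 h1) ((skip_lt_iff ..).2 h2) ((skip_lt_iff ..).2 h3) h4 h5

theorem step_deleted {i d : ℕ} {R : ℕ → ℕ → Prop}
    (hd : ∀ a b, R a b → ((i ≤ a ∧ a < i + d) ↔ (i ≤ b ∧ b < i + d))) (a : ℕ) :
    step (deleted i d R) a = step R (skip i d a) := by
  have h1 : (∃ b, a < b ∧ deleted i d R a b) ↔ ∃ b, skip i d a < b ∧ R (skip i d a) b := by
    constructor
    · rintro ⟨b, hb, hr⟩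
      exact ⟨skip i d b, (skip_lt_iff ..).2 hb, hr⟩
    · rintro ⟨b, hb, hr⟩
      obtain ⟨b, rfl⟩ := exists_skip fun h => skip_not_mem i d a ((hd _ _ hr).2 h)
      exact ⟨b, (skip_lt_iff ..).1 hb, hr⟩
  have h2 : (∃ b, b < a ∧ deleted i d R a b) ↔ ∃ b, b < skip i d a ∧ R (skip i d a) b := by
    constructor
    · rintro ⟨b, hb, hr⟩
      exact ⟨skip i d b, (skip_lt_iff ..).2 hb, hr⟩
    · rintro ⟨b, hb, hr⟩
      obtain ⟨b, rfl⟩ := exists_skip fun h => skip_not_mem i d a ((hd _ _ hr).2 h)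
      exact ⟨b, (skip_lt_iff ..).1 hb, hr⟩
  classical exact if_congr h1 rfl (if_congr h2 rfl rfl)

theorem path_take_drop {k i d : ℕ} {R : ℕ → ℕ → Prop} (hi : i ≤ k)
    (hd : ∀ a b, R a b → ((i ≤ a ∧ a < i + d) ↔ (i ≤ b ∧ b < i + d))) :
    path (k + d) R = (path k (deleted i d R)).take i ++ (List.range d).map (fun a => step R (i + a))
      ++ (path k (deleted i d R)).drop i := by
  apply List.ext_getElem
  · simp [path]; omega
  · intro a h1 h2
    simp only [path, List.length_map, List.length_range] at h1
    rcases lt_trichotomy a i with h | h | h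
    all_goals
      simp only [path, List.getElem_map, List.getElem_range, List.getElem_append,
        List.length_append, List.length_take, List.length_map, List.length_range, List.getElem_take,
        List.getElem_drop, step_deleted hd, skip]
      split_ifs <;> first | omega | (congr 1; omega)

/-- The value of a list of colours is constant on the blocks of the relation. -/
def ConstOn {E : Type} (R : ℕ → ℕ → Prop) (l : List E) : Prop := ∀ a b, R a b → l[a]? = l[b]?

theorem getElem?_take_append_drop {E : Type} (l : List E) {i d : ℕ} (hi : i ≤ l.length) (a : ℕ) :
    (l.take i ++ l.drop (i + d))[a]? = l[skip i d a]? := by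
  unfold skip
  rw [List.getElem?_append]
  have : min i l.length = i := by omega
  simp only [List.length_take, this, List.getElem?_take, List.getElem?_drop]
  split_ifs
  · rfl
  · congr 1; omega

theorem constOn_iff {E : Type} {i d : ℕ} {R : ℕ → ℕ → Prop} (l : List E) (hi : i ≤ l.length)
    (hd : ∀ a b, R a b → ((i ≤ a ∧ a < i + d) ↔ (i ≤ b ∧ b < i + d))) :
    ConstOn R l ↔ (∀ a b, R a b → (i ≤ a ∧ a < i + d) → l[a]? = l[b]?) ∧
      ConstOn (deleted i d R) (l.take i ++ l.drop (i + d)) := by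
  constructor
  · refine fun h => ⟨fun a b hab _ => h a b hab, fun a b hab => ?_⟩
    rw [getElem?_take_append_drop l hi, getElem?_take_append_drop l hi]
    exact h _ _ hab
  · rintro ⟨h1, h2⟩ a b hab
    by_cases ha : i ≤ a ∧ a < i + d
    · exact h1 a b hab ha
    · obtain ⟨a, rfl⟩ := exists_skip ha
      obtain ⟨b, rfl⟩ := exists_skip fun h => ha ((hd _ _ hab).2 h)
      have := h2 a b hab
      rwa [getElem?_take_append_drop l hi, getElem?_take_append_drop l hi] at this

/-- A nonempty diagram has a singleton or a pair of neighbours. -/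
theorem IsDiag.exists_innermost {k : ℕ} {R : ℕ → ℕ → Prop} (hR : IsDiag (k + 1) R) :
    (∃ i, i ≤ k ∧ ∀ b, R i b → b = i) ∨ ∃ i, i + 1 ≤ k ∧ R i (i + 1) := by
  by_contra! hcon
  obtain ⟨h1, h2⟩ := hcon
  have key : ∀ m a, ¬ R a (a + 1 + m) := by
    intro m
    induction m using Nat.strong_induction_on with
    | _ m ih =>
      intro a hab
      have hb := hR.lt_right hab
      rcases Nat.eq_zero_or_pos m with rfl | hm
      · exact h2 a (by omega) hab
      · obtain ⟨c, hc, hne⟩ := h1 (a + 1) (by omega)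
        have hca := hR.symm _ _ hc
        have c1 : c ≠ a := by
          rintro rfl
          have := hR.uniq _ _ _ hca hab (by omega) (by omega)
          omega
        have c2 : c ≠ a + 1 + m := by
          rintro rfl
          have := hR.uniq _ _ _ hca (hR.symm _ _ hab) (by omega) (by omega)
          omega
        rcases lt_or_gt_of_ne c1 with h | h
        · exact hR.nc c a (a + 1) (a + 1 + m) h (by omega) (by omega) hca hab
        · rcases lt_or_gt_of_ne c2 with h' | h'
          · obtain ⟨m', rfl⟩ : ∃ m', c = a + 1 + 1 + m' := ⟨c - a - 2, by omega⟩
            exact ih m' (by omega) (a + 1) hc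
          · exact hR.nc a (a + 1) (a + 1 + m) c (by omega) (by omega) h' hab hc
  obtain ⟨c, hc, hne⟩ := h1 0 (by omega)
  obtain ⟨m, rfl⟩ : ∃ m, c = 0 + 1 + m := ⟨c - 1, by omega⟩
  exact key m 0 hc

/-! ### The colouring model -/

/-- The model with one vertex and two edges, with loop parameter `2`. -/
def colourModel : DiagramModel ℚ Unit (Fin 2) where
  n := 2
  act _ _ := ()
  bar e := e
  Ok _ _ := True
  s _ _ := 1
  c _ _ := 1
  d _ _ := 1
  bar_bar _ := rfl
  act_bar _ _ _ := rfl
  ok_bar _ _ _ := trivial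
  c_ok _ _ h := absurd trivial h
  s_ok _ _ h := absurd trivial h
  s_act _ _ h := absurd rfl h
  loop _ := by norm_num
  zig _ _ _ := by norm_num
  s_loop _ := by norm_num
  s_left _ _ := by norm_num
  s_right _ _ := by norm_num
  c_left _ _ := by norm_num
  c_right _ _ := by norm_num

theorem colourModel_capAt (i : ℕ) (φ : List (Fin 2) → ℚ) (l : List (Fin 2))
    (hi : i + 2 ≤ l.length) : colourModel.capAt i () φ l =
      if l[i]? = l[i + 1]? then φ (l.take i ++ l.drop (i + 2)) else 0 := by
  induction i generalizing φ l with
  | zero =>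
    rcases l with _ | ⟨e, _ | ⟨e', l⟩⟩
    · simp at hi
    · simp at hi
    · simp [DiagramModel.capAt, colourModel, eq_comm]
  | succ i ih =>
    rcases l with _ | ⟨e, l⟩
    · simp at hi
    · simp only [DiagramModel.capAt]
      change colourModel.capAt i () _ _ = _
      rw [ih _ _ (by simpa using hi)]
      simp

theorem colourModel_singleAt (i : ℕ) (φ : List (Fin 2) → ℚ) (l : List (Fin 2))
    (hi : i + 1 ≤ l.length) : colourModel.singleAt i () φ l =
      φ (l.take i ++ l.drop (i + 1)) := by
  induction i generalizing φ l with
  | zero =>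
    rcases l with _ | ⟨e, l⟩
    · simp at hi
    · simp [DiagramModel.singleAt, colourModel]
  | succ i ih =>
    rcases l with _ | ⟨e, l⟩
    · simp at hi
    · simp only [DiagramModel.singleAt]
      change colourModel.singleAt i () _ _ = _
      rw [ih _ _ (by simpa using hi)]
      simp

/-- The Motzkin path of a diagram built by insertions. -/
def opsPath : List Op → List (Fin 3)
  | [] => []
  | Op.cap i :: v => (opsPath v).take i ++ 2 :: 0 :: (opsPath v).drop i
  | Op.single i :: v => (opsPath v).take i ++ 1 :: (opsPath v).drop i

open Classical in
/-- Every diagram is built by insertions. -/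
theorem IsDiag.exists_ops {k : ℕ} {R : ℕ → ℕ → Prop} (hR : IsDiag k R) :
    ∃ v : List Op, OpsValid v ∧ opsLength v = k ∧ opsPath v = path k R ∧
      ∀ l : List (Fin 2), l.length = k →
        colourModel.vec v () l = if ConstOn R l then 1 else 0 := by
  induction k using Nat.strong_induction_on generalizing R with
  | _ k ih =>
    rcases k with _ | k
    · refine ⟨[], trivial, rfl, rfl, fun l hl => ?_⟩
      rw [List.length_eq_zero_iff] at hl
      subst hl
      rw [if_pos]
      · rfl
      · intro a b hab
        exact absurd (hR.lt _ _ hab) (by omega)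
    · rcases hR.exists_innermost with ⟨i, hi, hs⟩ | ⟨i, hi, hp⟩
      · have hd : ∀ a b, R a b → ((i ≤ a ∧ a < i + 1) ↔ (i ≤ b ∧ b < i + 1)) := by
          intro a b hab
          constructor
          · intro h
            obtain rfl : a = i := by omega
            have := hs _ hab
            omega
          · intro h
            obtain rfl : b = i := by omega
            have := hs _ (hR.symm _ _ hab)
            omega
        obtain ⟨v, hv, hl, hp, hc⟩ := ih k (by omega) (hR.deleted (d := 1) hi)
        refine ⟨Op.single i :: v, ⟨by omega, hv⟩, by rw [opsLength, hl], ?_, ?_⟩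
        · rw [path_take_drop hi hd, opsPath, hp]
          have : step R i = 1 := by
            unfold step
            rw [if_neg, if_neg]
            · rintro ⟨b, hb, hr⟩
              have := hs _ hr; omega
            · rintro ⟨b, hb, hr⟩
              have := hs _ hr; omega
          simp [this]
        · intro l hl
          rw [DiagramModel.vec_single, colourModel_singleAt _ _ _ (by omega),
            hc _ (by simp; omega)]
          congr 1
          rw [constOn_iff (i := i) (d := 1) l (by omega) hd, eq_iff_iff]
          refine ⟨fun h => ⟨fun a b hab ha => ?_, h⟩, fun h => h.2⟩
          obtain rfl : a = i := by omega
          rw [hs _ hab]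
      · obtain ⟨k, rfl⟩ : ∃ k', k = k' + 1 := ⟨k - 1, by omega⟩
        have hp' := hR.symm _ _ hp
        have hd : ∀ a b, R a b → ((i ≤ a ∧ a < i + 2) ↔ (i ≤ b ∧ b < i + 2)) := by
          have : ∀ a b, R a b → (i ≤ a ∧ a < i + 2) → (i ≤ b ∧ b < i + 2) := by
            intro a b hab h
            obtain rfl | rfl : a = i ∨ a = i + 1 := by omega
            · by_cases hb : a = b
              · omega
              · have := hR.uniq _ _ _ hab hp hb (by omega)
                omega
            · by_cases hb : i + 1 = b
              · omega
              · have := hR.uniq _ _ _ hab hp' hb (by omega)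
                omega
          exact fun a b hab => ⟨this a b hab, this b a (hR.symm _ _ hab)⟩
        obtain ⟨v, hv, hl, hpa, hc⟩ := ih k (by omega)
          (hR.deleted (k := k) (i := i) (d := 2) (by omega))
        refine ⟨Op.cap i :: v, ⟨by omega, hv⟩, by rw [opsLength, hl], ?_, ?_⟩
        · rw [path_take_drop (k := k) (d := 2) (by omega) hd, opsPath, hpa]
          have h2 : step R i = 2 := by
            unfold step
            rw [if_pos ⟨i + 1, by omega, hp⟩]
          have h0 : step R (i + 1) = 0 := by
            unfold step
            rw [if_neg, if_pos ⟨i, by omega, hp'⟩]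
            rintro ⟨b, hb, hr⟩
            have := hR.uniq _ _ _ hr hp' (by omega) (by omega)
            omega
          simp [h2, h0, List.range_succ]
        · intro l hl
          rw [DiagramModel.vec_cap, colourModel_capAt _ _ _ (by omega),
            hc _ (by simp; omega), ← ite_and]
          congr 1
          rw [constOn_iff (i := i) (d := 2) l (by omega) hd, eq_iff_iff]
          refine ⟨fun h => ⟨fun a b hab ha => ?_, h.2⟩, fun h => ⟨h.1 _ _ hp (by omega), h.2⟩⟩
          have hb := (hd _ _ hab).1 ha
          obtain rfl | rfl : a = i ∨ a = i + 1 := by omega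
          · obtain rfl | rfl : b = a ∨ b = a + 1 := by omega
            · rfl
            · exact h.1
          · obtain rfl | rfl : b = i ∨ b = i + 1 := by omega
            · exact h.1.symm
            · rfl

theorem colourModel_form (k : ℕ) (φ ψ : List (Fin 2) → ℚ) :
    colourModel.form k () φ ψ =
      ∑ f : Fin k → Fin 2, φ (List.ofFn f) * ψ (List.ofFn f) := by
  induction k generalizing φ ψ with
  | zero => simp [DiagramModel.form]
  | succ k ih =>
    rw [DiagramModel.form, ← (Fin.consEquiv fun _ => Fin 2).sum_comp, Fintype.sum_prod_type]
    refine Finset.sum_congr rfl fun e _ => ?_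
    have := ih (fun l => φ (e :: l)) (fun l => ψ (e :: l))
    rw [show colourModel.d () e = 1 from rfl, one_mul, this]
    simp [Fin.consEquiv, List.ofFn_succ]

/-! ### Diagrams as partitions -/

/-- The relation on natural numbers of a partition. -/
def natRel {k : ℕ} (π : Setoid (Fin k)) (a b : ℕ) : Prop :=
  ∃ (ha : a < k) (hb : b < k), π ⟨a, ha⟩ ⟨b, hb⟩

theorem natRel_iff {k : ℕ} (π : Setoid (Fin k)) (a b : Fin k) : natRel π a b ↔ π a b :=
  ⟨fun ⟨_, _, h⟩ => h, fun h => ⟨a.2, b.2, h⟩⟩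

theorem constOn_natRel {k : ℕ} (π : Setoid (Fin k)) {E : Type} (f : Fin k → E) :
    ConstOn (natRel π) (List.ofFn f) ↔ π ≤ Setoid.ker f := by
  constructor
  · intro h a b hab
    have := h a b ((natRel_iff π a b).2 hab)
    simpa [Setoid.ker_def] using this
  · rintro h a b ⟨ha, hb, hab⟩
    have : f ⟨a, ha⟩ = f ⟨b, hb⟩ := h hab
    simp [ha, hb, this]

open Classical in
theorem sum_constOn {k : ℕ} (π σ : Setoid (Fin k)) :
    (∑ f : Fin k → Fin 2, (if ConstOn (natRel π) (List.ofFn f) then (1 : ℚ) else 0) *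
      if ConstOn (natRel σ) (List.ofFn f) then 1 else 0) = 2 ^ blockCount (π ⊔ σ) := by
  have h1 : ∀ f : Fin k → Fin 2, ((if ConstOn (natRel π) (List.ofFn f) then (1 : ℚ) else 0) *
      if ConstOn (natRel σ) (List.ofFn f) then 1 else 0) =
        if π ⊔ σ ≤ Setoid.ker f then 1 else 0 := by
    intro f
    simp only [constOn_natRel, sup_le_iff]
    split_ifs <;> simp_all
  rw [Finset.sum_congr rfl fun f _ => h1 f, Finset.sum_boole, ← Fintype.card_subtype,
    Fintype.card_congr (Setoid.liftEquiv (π ⊔ σ)), ← Nat.card_eq_fintype_card, Nat.card_fun]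
  rw [Nat.card_congr (Setoid.quotientEquivClasses (π ⊔ σ))]
  rw [Nat.card_coe_set_eq]
  simp [blockCount]

theorem natRel_uniq {k : ℕ} (π : FreeBistochasticPartition k) (a b c : ℕ)
    (h1 : natRel π.1 a b) (h2 : natRel π.1 a c) (hab : a ≠ b) (hac : a ≠ c) : b = c := by
  obtain ⟨ha, hb, h1⟩ := h1
  obtain ⟨_, hc, h2⟩ := h2
  by_contra hbc
  have hB := π.2.2 _ (Setoid.mem_classes π.1 ⟨a, ha⟩)
  have hsub : (({⟨a, ha⟩, ⟨b, hb⟩, ⟨c, hc⟩} : Finset (Fin k)) : Set (Fin k)) ⊆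
      {x | π.1 x ⟨a, ha⟩} := by
    intro x hx
    simp only [Finset.coe_insert, Finset.coe_singleton, Set.mem_insert_iff,
      Set.mem_singleton_iff] at hx
    rcases hx with rfl | rfl | rfl
    · exact π.1.refl _
    · exact π.1.symm h1
    · exact π.1.symm h2
  have := Set.ncard_le_ncard hsub
  rw [Set.ncard_coe_finset, Finset.card_eq_three.2 ⟨_, _, _, ?_, ?_, ?_, rfl⟩] at this
  · omega
  all_goals simpa using by assumption

theorem isDiag_natRel {k : ℕ} (π : FreeBistochasticPartition k) : IsDiag k (natRel π.1) where
  lt _ _ h := h.1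
  refl a h := ⟨h, h, π.1.refl _⟩
  symm _ _ := fun ⟨ha, hb, h⟩ => ⟨hb, ha, π.1.symm h⟩
  uniq := natRel_uniq π
  nc a b c d h1 h2 h3 := by
    intro hac hbd
    have hab : natRel π.1 a b := (natRel_iff π.1 ⟨a, hac.1⟩ ⟨b, hbd.1⟩).2
      (π.2.1 _ _ ⟨c, hac.2.1⟩ ⟨d, hbd.2.1⟩ h1 h2 h3 ((natRel_iff ..).1 hac)
        ((natRel_iff ..).1 hbd))
    have := natRel_uniq π _ _ _ hab hac (by omega) (by omega)
    omega

theorem IsDiag.exists_partition {k : ℕ} {R : ℕ → ℕ → Prop} (hR : IsDiag k R) :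
    ∃ π : FreeBistochasticPartition k, natRel π.1 = R := by
  have htrans : ∀ a b c, R a b → R b c → R a c := by
    intro a b c hab hbc
    by_cases h1 : b = a
    · rwa [h1] at hbc
    by_cases h2 : b = c
    · rwa [← h2]
    obtain rfl := hR.uniq _ _ _ (hR.symm _ _ hab) hbc h1 h2
    exact hR.refl _ (hR.lt _ _ hab)
  let π : Setoid (Fin k) :=
    { r := fun a b => R a b
      iseqv := ⟨fun a => hR.refl a a.2, fun h => hR.symm _ _ h, fun h h' => htrans _ _ _ h h'⟩ }
  have hπ : ∀ a b : Fin k, π a b ↔ R a b := fun a b => Iff.rfl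
  refine ⟨⟨π, ?_, ?_⟩, ?_⟩
  · intro a b c d h1 h2 h3 hac hbd
    exact (hR.nc a b c d h1 h2 h3 hac hbd).elim
  · rintro B ⟨y, rfl⟩
    by_cases hy : ∃ x : Fin k, R y x ∧ x ≠ y
    · obtain ⟨x, hx, hne⟩ := hy
      right
      rw [Set.ncard_eq_two]
      refine ⟨x, y, hne, Set.ext fun z => ?_⟩
      constructor
      · intro hz
        by_cases hzy : z = y
        · exact Or.inr hzy
        · exact Or.inl (Fin.ext (hR.uniq y z x (hR.symm _ _ hz) hx
            (fun h => hzy (Fin.ext h.symm)) (fun h => hne (Fin.ext h.symm))))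
      · rintro (rfl | rfl)
        · exact hR.symm _ _ hx
        · exact hR.refl _ z.2
    · left
      rw [Set.ncard_eq_one]
      refine ⟨y, Set.ext fun z => ?_⟩
      constructor
      · intro hz
        by_contra hzy
        exact hy ⟨z, hR.symm _ _ hz, hzy⟩
      · rintro rfl
        exact hR.refl _ z.2
  · funext a b
    rw [eq_iff_iff]
    exact ⟨fun ⟨_, _, h⟩ => h, fun h => ⟨hR.lt _ _ h, hR.lt_right h, h⟩⟩

theorem natRel_injective {k : ℕ} {π σ : Setoid (Fin k)} (h : natRel π = natRel σ) : π = σ :=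
  Setoid.ext fun a b => by rw [← natRel_iff π, ← natRel_iff σ, h]

/-! ### Diagrams and Motzkin paths -/

theorem step_eq_two {R : ℕ → ℕ → Prop} {a : ℕ} : step R a = 2 ↔ ∃ b, a < b ∧ R a b := by
  unfold step
  split_ifs with h1 h2
  · simp [h1]
  · simp only [h1, iff_false]; decide
  · simp only [h1, iff_false]; decide

theorem IsDiag.step_eq_zero {k : ℕ} {R : ℕ → ℕ → Prop} (hR : IsDiag k R) {a : ℕ} :
    step R a = 0 ↔ ∃ b, b < a ∧ R a b := by
  unfold step
  split_ifs with h1 h2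
  · refine ⟨fun h => absurd h (by decide), ?_⟩
    rintro ⟨b, hb, hr⟩
    obtain ⟨c, hc, hr'⟩ := h1
    have := hR.uniq _ _ _ hr hr' (by omega) (by omega)
    omega
  · simp [h2]
  · simp only [h2, iff_false]; decide

theorem step_eq_of_path {k : ℕ} {R S : ℕ → ℕ → Prop} (h : path k R = path k S) (a : ℕ)
    (ha : a < k) : step R a = step S a := by
  have := congrArg (fun l => l[a]?) h
  simpa [path, ha] using this

theorem IsDiag.rel_of_path_eq {k : ℕ} (m : ℕ) {R S : ℕ → ℕ → Prop} (hR : IsDiag k R)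
    (hS : IsDiag k S) (h : path k R = path k S) (a : ℕ) (hab : R a (a + m)) : S a (a + m) := by
  induction m using Nat.strong_induction_on generalizing R S a with
  | _ m ih =>
    have ha := hR.lt _ _ hab
    have hb := hR.lt_right hab
    rcases Nat.eq_zero_or_pos m with rfl | hm
    · exact hS.refl _ ha
    obtain ⟨b', hb', hs⟩ := step_eq_two.1
      ((step_eq_of_path h a ha).symm.trans (step_eq_two.2 ⟨a + m, by omega, hab⟩))
    have hbk := hS.lt_right hs
    rcases lt_trichotomy b' (a + m) with hlt | heq | hgt
    · obtain ⟨c, hc, hr⟩ := hR.step_eq_zero.1 ((step_eq_of_path h b' hbk).trans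
        (hS.step_eq_zero.2 ⟨a, hb', hS.symm _ _ hs⟩))
      have hr' := hR.symm _ _ hr
      have hca : c ≠ a := by
        rintro rfl
        have := hR.uniq _ _ _ hr' hab (by omega) (by omega)
        omega
      rcases lt_or_gt_of_ne hca with h1 | h1
      · exact (hR.nc c a b' (a + m) h1 hb' hlt hr' hab).elim
      · obtain ⟨m', rfl⟩ : ∃ m', b' = c + m' := ⟨b' - c, by omega⟩
        have := ih m' (by omega) hR hS h c hr'
        exact absurd (hS.uniq _ _ _ (hS.symm _ _ this) (hS.symm _ _ hs) (by omega) (by omega)) hca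
    · rwa [← heq]
    · obtain ⟨c, hc, hr⟩ := hS.step_eq_zero.1 ((step_eq_of_path h (a + m) hb).symm.trans
        (hR.step_eq_zero.2 ⟨a, by omega, hR.symm _ _ hab⟩))
      have hr' := hS.symm _ _ hr
      have hca : c ≠ a := by
        rintro rfl
        have := hS.uniq _ _ _ hr' hs (by omega) (by omega)
        omega
      rcases lt_or_gt_of_ne hca with h1 | h1
      · exact (hS.nc c a (a + m) b' h1 (by omega) hgt hr' hs).elim
      · obtain ⟨m', hm'⟩ : ∃ m', a + m = c + m' := ⟨a + m - c, by omega⟩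
        rw [hm'] at hr' hab
        have := ih m' (by omega) hS hR h.symm c hr'
        exact absurd (hR.uniq _ _ _ (hR.symm _ _ this) (hR.symm _ _ hab) (by omega) (by omega)) hca

theorem path_injective {k : ℕ} {π σ : FreeBistochasticPartition k}
    (h : path k (natRel π.1) = path k (natRel σ.1)) : π = σ := by
  have key : ∀ (π σ : FreeBistochasticPartition k), path k (natRel π.1) = path k (natRel σ.1) →
      ∀ a b, natRel π.1 a b → natRel σ.1 a b := by
    intro π σ h a b hab
    rcases le_total a b with hle | hle
    · obtain ⟨m, rfl⟩ := Nat.exists_eq_add_of_le hle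
      exact (isDiag_natRel π).rel_of_path_eq m (isDiag_natRel σ) h a hab
    · obtain ⟨m, rfl⟩ := Nat.exists_eq_add_of_le hle
      exact (isDiag_natRel σ).symm _ _ ((isDiag_natRel π).rel_of_path_eq m (isDiag_natRel σ) h b
        ((isDiag_natRel π).symm _ _ hab))
  exact Subtype.ext (natRel_injective (funext fun a => funext fun b =>
    propext ⟨key π σ h a b, key σ π h.symm a b⟩))

/-- Motzkin paths of length `k` from height `h` to height `0`. -/
def IsMotzkin : ℕ → List (Fin 3) → Prop
  | h, [] => h = 0
  | h, e :: l => 1 ≤ h + (e : ℕ) ∧ IsMotzkin (h + e - 1) l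

/-- The height before the step `a`. -/
def height (l : List (Fin 3)) : ℕ → ℤ
  | 0 => 0
  | a + 1 => height l a + ((l.getD a 1 : Fin 3) : ℕ) - 1

/-- The pairs of the diagram of a Motzkin path. -/
def motzkinPair (l : List (Fin 3)) (a b : ℕ) : Prop :=
  a < b ∧ b < l.length ∧ height l a = height l (b + 1) ∧
    ∀ c, a < c → c ≤ b → height l a < height l c

/-- The diagram of a Motzkin path. -/
def motzkinRel (l : List (Fin 3)) (a b : ℕ) : Prop :=
  (a = b ∧ a < l.length) ∨ motzkinPair l a b ∨ motzkinPair l b a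

theorem height_succ_le (l : List (Fin 3)) (a : ℕ) : height l (a + 1) ≤ height l a + 1 := by
  rw [height]; have := (l.getD a 1).2; omega

theorem height_le_succ (l : List (Fin 3)) (a : ℕ) : height l a ≤ height l (a + 1) + 1 := by
  rw [height]; omega

theorem height_cons (e : Fin 3) (l : List (Fin 3)) (a : ℕ) :
    height (e :: l) (a + 1) = (e : ℕ) - 1 + height l a := by
  induction a with
  | zero => simp [height]
  | succ a ih => rw [height, ih, height]; simp; ring

theorem IsMotzkin.height {h : ℕ} {l : List (Fin 3)} (hl : IsMotzkin h l) :
    (∀ a, a ≤ l.length → 0 ≤ h + height l a) ∧ h + BistochasticGram.height l l.length = 0 := by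
  induction l generalizing h with
  | nil =>
    simp only [IsMotzkin] at hl
    subst hl
    simp [BistochasticGram.height]
  | cons e l ih =>
    obtain ⟨h1, h2⟩ := hl
    have := ih h2
    have hc : (((h + e - 1 : ℕ)) : ℤ) = h + (e : ℕ) - 1 := by omega
    rw [hc] at this
    constructor
    · intro a ha
      rcases a with _ | a
      · simp [BistochasticGram.height]
      · rw [height_cons]
        have := this.1 a (by simpa using ha)
        linarith
    · rw [List.length_cons, height_cons]
      linarith

theorem motzkinPair_left_unique {l : List (Fin 3)} {a b c : ℕ} (h1 : motzkinPair l a b)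
    (h2 : motzkinPair l a c) : b = c := by
  obtain ⟨h1, -, h3, h4⟩ := h1
  obtain ⟨h5, -, h7, h8⟩ := h2
  by_contra hne
  rcases lt_or_gt_of_ne hne with h | h
  · have := h8 (b + 1) (by omega) (by omega); omega
  · have := h4 (c + 1) (by omega) (by omega); omega

theorem motzkinPair_right_unique {l : List (Fin 3)} {a b c : ℕ} (h1 : motzkinPair l a c)
    (h2 : motzkinPair l b c) : a = b := by
  obtain ⟨h1, -, h3, h4⟩ := h1
  obtain ⟨h5, -, h7, h8⟩ := h2
  by_contra hne
  rcases lt_or_gt_of_ne hne with h | h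
  · have := h4 b (by omega) (by omega); omega
  · have := h8 a (by omega) (by omega); omega

theorem motzkinPair_not_chain {l : List (Fin 3)} {a b c : ℕ} (h1 : motzkinPair l a b)
    (h2 : motzkinPair l b c) : False := by
  obtain ⟨h1, -, h3, h4⟩ := h1
  obtain ⟨h5, -, h7, h8⟩ := h2
  have := h4 b (by omega) (by omega)
  have := h8 (b + 1) (by omega) (by omega)
  omega

theorem motzkinRel_of_lt {l : List (Fin 3)} {a b : ℕ} (hab : a < b) :
    motzkinRel l a b ↔ motzkinPair l a b := by
  constructor
  · rintro (⟨h, -⟩ | h | h)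
    · omega
    · exact h
    · exact absurd h.1 (by omega)
  · exact fun h => Or.inr (Or.inl h)

theorem motzkinRel_of_gt {l : List (Fin 3)} {a b : ℕ} (hab : b < a) :
    motzkinRel l a b ↔ motzkinPair l b a := by
  constructor
  · rintro (⟨h, -⟩ | h | h)
    · omega
    · exact absurd h.1 (by omega)
    · exact h
  · exact fun h => Or.inr (Or.inr h)

theorem isDiag_motzkinRel (l : List (Fin 3)) : IsDiag l.length (motzkinRel l) where
  lt a b := by
    rintro (h | h | h)
    · exact h.2
    · exact h.1.trans h.2.1
    · exact h.2.1
  refl a h := Or.inl ⟨rfl, h⟩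
  symm a b := by
    rintro (⟨rfl, h⟩ | h | h)
    · exact Or.inl ⟨rfl, h⟩
    · exact Or.inr (Or.inr h)
    · exact Or.inr (Or.inl h)
  uniq a b c := by
    rintro (⟨rfl, h1⟩ | h1 | h1) (⟨rfl, h2⟩ | h2 | h2) hab hac
    · rfl
    · exact absurd rfl hab
    · exact absurd rfl hab
    · exact absurd rfl hac
    · exact motzkinPair_left_unique h1 h2
    · exact (motzkinPair_not_chain h2 h1).elim
    · exact absurd rfl hac
    · exact (motzkinPair_not_chain h1 h2).elim
    · exact motzkinPair_right_unique h1 h2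
  nc a b c d hab hbc hcd := by
    intro h1 h2
    rw [motzkinRel_of_lt (by omega)] at h1 h2
    obtain ⟨-, -, h3, h4⟩ := h1
    obtain ⟨-, -, h5, h6⟩ := h2
    have := h4 b (by omega) (by omega)
    have := h6 (c + 1) (by omega) (by omega)
    omega

theorem path_motzkinRel {l : List (Fin 3)} (hl : IsMotzkin 0 l) :
    path l.length (motzkinRel l) = l := by
  obtain ⟨hnn, hend⟩ := hl.height
  simp only [Nat.cast_zero, zero_add] at hnn hend
  have hD := isDiag_motzkinRel l
  apply List.ext_getElem (by simp [path])
  intro a h1 h2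
  have hget : l.getD a 1 = l[a] := by simp [List.getD_eq_getElem?_getD, h2]
  simp only [path, List.getElem_map, List.getElem_range]
  have hs : height l (a + 1) = height l a + ((l[a] : Fin 3) : ℕ) - 1 := by rw [height, hget]
  have hup : (∃ b, a < b ∧ motzkinRel l a b) ↔ l[a] = 2 := by
    constructor
    · rintro ⟨b, hb, hr⟩
      rw [motzkinRel_of_lt hb] at hr
      have := hr.2.2.2 (a + 1) (by omega) (by omega)
      ext; simp; omega
    · intro h
      rw [h] at hs
      simp at hs
      have hex : ∃ b, a < b ∧ height l (b + 1) ≤ height l a := by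
        refine ⟨l.length - 1, ?_, ?_⟩
        · by_contra hcon
          have : a + 1 = l.length := by omega
          rw [this, hend] at hs
          have := hnn a (by omega)
          omega
        · rw [show l.length - 1 + 1 = l.length by omega, hend]
          exact hnn a (by omega)
      classical
      obtain ⟨hb, hle⟩ := Nat.find_spec hex
      have hmin := fun c => Nat.find_min (m := c) hex
      set b := Nat.find hex
      have hin : ∀ c, a < c → c ≤ b → height l a < height l c := by
        intro c hac hcb
        rcases Nat.eq_or_lt_of_le (Nat.succ_le_of_lt hac) with h' | h'
        · rw [← h', Nat.succ_eq_add_one]; omega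
        · have := hmin (c - 1) (by omega)
          rw [show c - 1 + 1 = c by omega] at this
          by_contra hcon
          exact this ⟨by omega, by omega⟩
      refine ⟨b, hb, (motzkinRel_of_lt hb).2 ⟨hb, ?_, ?_, hin⟩⟩
      · have := hmin (l.length - 1)
        rw [show l.length - 1 + 1 = l.length by omega, hend] at this
        have h0 := hnn a (by omega)
        by_contra hcon
        refine this (by omega) ⟨?_, h0⟩
        by_contra hcon'
        have : a + 1 = l.length := by omega
        rw [this, hend] at hs
        omega
      · have := hin b hb le_rfl
        have := height_le_succ l b
        omega
  have hdown : (∃ b, b < a ∧ motzkinRel l a b) ↔ l[a] = 0 := by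
    constructor
    · rintro ⟨b, hb, hr⟩
      rw [motzkinRel_of_gt hb] at hr
      have := hr.2.2.2 a (by omega) (by omega)
      have := hr.2.2.1
      ext; simp; omega
    · intro h
      rw [h] at hs
      simp at hs
      have hpos := hnn (a + 1) (by omega)
      classical
      have hex : ∃ m, m < a ∧ height l (a - 1 - m) ≤ height l (a + 1) := by
        have : a ≠ 0 := by
          rintro rfl
          rw [show height l 0 = 0 from rfl] at hs
          omega
        refine ⟨a - 1, by omega, ?_⟩
        rw [show a - 1 - (a - 1) = 0 by omega]
        exact hpos
      obtain ⟨hb, hle⟩ := Nat.find_spec hex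
      have hmin := fun c => Nat.find_min (m := c) hex
      set m := Nat.find hex
      have hin : ∀ c, a - 1 - m < c → c ≤ a → height l (a + 1) < height l c := by
        intro c hac hcb
        rcases Nat.eq_or_lt_of_le hcb with h' | h'
        · rw [h']; omega
        · have := hmin (a - 1 - c) (by omega)
          rw [show a - 1 - (a - 1 - c) = c by omega] at this
          by_contra hcon
          exact this ⟨by omega, by omega⟩
      have heq : height l (a - 1 - m) = height l (a + 1) := by
        have := hin (a - 1 - m + 1) (by omega) (by omega)
        have := height_succ_le l (a - 1 - m)
        omega
      refine ⟨a - 1 - m, by omega, (motzkinRel_of_gt (by omega)).2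
        ⟨by omega, h2, heq, by rw [heq]; exact hin⟩⟩
  unfold step
  simp only [hup, hdown]
  have := (l[a]).2
  split_ifs with h3 h4
  · exact h3.symm
  · exact h4.symm
  · rw [Fin.ext_iff] at h3 h4 ⊢
    simp at h3 h4 ⊢
    omega

/-! ### Counting Motzkin paths -/

/-- The number of walks with `m` steps `±1` from `0` to `j`. -/
def walk : ℕ → ℤ → ℤ
  | 0, j => if j = 0 then 1 else 0
  | m + 1, j => walk m (j - 1) + walk m (j + 1)

/-- The number of walks with `k` steps `-1, 0, 1` from `0` to `j`. -/
def lazyWalk : ℕ → ℤ → ℤ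
  | 0, j => if j = 0 then 1 else 0
  | k + 1, j => lazyWalk k (j - 1) + lazyWalk k j + lazyWalk k (j + 1)

theorem binom_succ (m : ℕ) (j : ℤ) : binom (m + 1) j = binom m j + binom m (j - 1) := by
  unfold binom
  rcases lt_trichotomy j 0 with h | rfl | h
  · rw [if_neg (by omega), if_neg (by omega), if_neg (by omega)]; rfl
  · simp
  · obtain ⟨i, rfl⟩ : ∃ i : ℕ, j = i + 1 := ⟨(j - 1).toNat, by omega⟩
    rw [if_pos (by omega), if_pos (by omega), if_pos (by omega)]
    rw [show ((i : ℤ) + 1).toNat = i + 1 by omega, show ((i : ℤ) + 1 - 1).toNat = i by omega,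
      Nat.choose_succ_succ]
    push_cast; ring

theorem walk_odd (m : ℕ) (j : ℤ) (h : (m + j) % 2 = 1) : walk m j = 0 := by
  induction m generalizing j with
  | zero => rw [walk, if_neg]; rintro rfl; simp at h
  | succ m ih =>
    push_cast at h
    rw [walk, ih _ (by omega), ih _ (by omega), add_zero]

theorem walk_even (l : ℕ) (r : ℤ) : walk (2 * l) (2 * r) = binom (2 * l) (l - r) := by
  induction l generalizing r with
  | zero =>
    simp only [Nat.mul_zero, walk, binom]
    rcases lt_trichotomy r 0 with h | rfl | h
    · rw [if_neg (by omega), if_pos (by simp; omega), Nat.choose_eq_zero_of_lt (by simp; omega)]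
      rfl
    · simp
    · rw [if_neg (by omega), if_neg (by simp; omega)]
  | succ l ih =>
    rw [show 2 * (l + 1) = 2 * l + 1 + 1 by ring, walk, walk, walk,
      show 2 * r - 1 - 1 = 2 * (r - 1) by ring, show 2 * r - 1 + 1 = 2 * r by ring,
      show 2 * r + 1 - 1 = 2 * r by ring, show 2 * r + 1 + 1 = 2 * (r + 1) by ring, ih, ih, ih,
      binom_succ, binom_succ, binom_succ]
    push_cast
    rw [show (l : ℤ) + 1 - r - 1 = l - r by ring, show (l : ℤ) + 1 - r = l - (r - 1) by ring,
      show (l : ℤ) - r - 1 = l - (r + 1) by ring]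

theorem lazyWalk_eq_sum (k : ℕ) (j : ℤ) :
    lazyWalk k j = ∑ m ∈ Finset.range (k + 1), (k.choose m : ℤ) * walk m j := by
  induction k generalizing j with
  | zero => simp [lazyWalk, walk]
  | succ k ih =>
    rw [lazyWalk, ih, ih, ih, Finset.sum_range_succ' _ (k + 1)]
    simp only [Nat.choose_succ_succ, Nat.cast_add, add_mul, Finset.sum_add_distrib, walk, mul_add]
    rw [Finset.sum_range_succ (fun m => ((k.choose (m + 1) : ℕ) : ℤ) * walk m (j - 1)),
      Finset.sum_range_succ (fun m => ((k.choose (m + 1) : ℕ) : ℤ) * walk m (j + 1)),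
      Finset.sum_range_succ' (fun m => ((k.choose m : ℕ) : ℤ) * walk m j)]
    simp only [walk, mul_add, Finset.sum_add_distrib]
    simp
    ring

theorem lazyWalk_neg (k : ℕ) (j : ℤ) : lazyWalk k (-j) = lazyWalk k j := by
  induction k generalizing j with
  | zero => simp [lazyWalk]
  | succ k ih =>
    rw [lazyWalk, lazyWalk, ← neg_add', ih, ih, show -j + 1 = -(j - 1) by ring, ih]; ring

/-- The number of Motzkin paths of length `k` from height `h` to height `0`. -/
def pathCount : ℕ → ℕ → ℕ
  | 0, h => if h = 0 then 1 else 0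
  | k + 1, h => (if h = 0 then 0 else pathCount k (h - 1)) + pathCount k h + pathCount k (h + 1)

/-- The total number of up steps to height `r` in these paths. -/
def upCount (r : ℕ) : ℕ → ℕ → ℕ
  | 0, _ => 0
  | k + 1, h => (if h = 0 then 0 else upCount r k (h - 1)) + upCount r k h + upCount r k (h + 1) +
      if h + 1 = r then pathCount k (h + 1) else 0

/-- The total number of flat steps in these paths. -/
def flatCount : ℕ → ℕ → ℕ
  | 0, _ => 0
  | k + 1, h => (if h = 0 then 0 else flatCount k (h - 1)) + flatCount k h + flatCount k (h + 1) +
      pathCount k h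

theorem pathCount_eq (k h : ℕ) :
    (pathCount k h : ℤ) = lazyWalk k h - lazyWalk k (h + 2) := by
  induction k generalizing h with
  | zero =>
    simp only [pathCount, lazyWalk]
    split_ifs <;> omega
  | succ k ih =>
    rcases h with _ | h
    · simp only [pathCount, if_true, lazyWalk]
      push_cast
      rw [ih, ih]
      have := lazyWalk_neg k 1
      push_cast
      norm_num at this ⊢
      rw [this]; ring
    · simp only [pathCount, lazyWalk, Nat.succ_ne_zero, if_false, Nat.add_sub_cancel]
      push_cast
      rw [ih, ih, ih]
      push_cast
      rw [show (h : ℤ) + 1 - 1 = h by ring, show (h : ℤ) + 1 + 2 - 1 = h + 2 by ring,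
        show (h : ℤ) + 1 + 2 + 1 = h + 1 + 1 + 2 by ring]
      ring

theorem pathCount_eq_zero {k h : ℕ} (hk : k < h) : pathCount k h = 0 := by
  induction k generalizing h with
  | zero => simp [pathCount]; omega
  | succ k ih =>
    rw [pathCount, if_neg (by omega), ih (by omega), ih (by omega), ih (by omega)]

theorem upCount_eq (r k h : ℕ) (hr : 1 ≤ r) : (upCount r k h : ℤ) =
    lazyWalk k (|(h : ℤ) - r + 1| + r + 1) - lazyWalk k (h + 2 * r + 2) := by
  induction k generalizing h with
  | zero =>
    have : 0 ≤ |(h : ℤ) - r + 1| := abs_nonneg _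
    simp only [upCount, lazyWalk]
    rw [if_neg (by omega), if_neg (by omega)]; rfl
  | succ k ih =>
    have hbase : ((if h = 0 then 0 else upCount r k (h - 1) : ℕ) : ℤ) =
        lazyWalk k (|(h : ℤ) - 1 - r + 1| + r + 1) - lazyWalk k (h - 1 + 2 * r + 2) := by
      split_ifs with h0
      · subst h0
        rw [abs_of_nonpos (by push_cast; omega)]
        push_cast
        ring_nf
      · rw [ih]
        rw [show ((h - 1 : ℕ) : ℤ) = h - 1 by omega]
    rw [upCount, Nat.cast_add, Nat.cast_add, Nat.cast_add, hbase, ih, ih, lazyWalk, lazyWalk]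
    push_cast
    rcases lt_trichotomy (h + 1) r with hlt | heq | hgt
    · rw [if_neg (by omega), abs_of_nonpos (by omega), abs_of_nonpos (by omega),
        abs_of_nonpos (by omega)]
      ring_nf
    · subst heq
      rw [if_pos rfl, pathCount_eq]
      push_cast
      rw [show (h : ℤ) - 1 - (h + 1) + 1 = -1 by ring, show (h : ℤ) - (h + 1) + 1 = 0 by ring,
        show (h : ℤ) + 1 - (h + 1) + 1 = 1 by ring]
      norm_num
      ring_nf
    · rw [if_neg (by omega), abs_of_nonneg (by omega), abs_of_nonneg (by omega),
        abs_of_nonneg (by omega)]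
      ring_nf

theorem fNum_eq_zero {l r : ℕ} (h : l < r) : fNum l r = 0 := by
  unfold fNum binom
  rw [if_neg (by omega), if_neg (by omega), sub_zero]

theorem upCount_zero_eq (r k : ℕ) (hr : 1 ≤ r) : (upCount r k 0 : ℤ) =
    ∑ l ∈ Finset.Icc 1 (k / 2), (k.choose (2 * l) : ℤ) * fNum l r := by
  rw [upCount_eq r k 0 hr, abs_of_nonpos (by push_cast; omega)]
  push_cast
  rw [show (-(0 - (r : ℤ) + 1) + r + 1) = 2 * r by ring,
    show (0 + 2 * (r : ℤ) + 2) = 2 * (r + 1) by ring, lazyWalk_eq_sum, lazyWalk_eq_sum,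
    ← Finset.sum_sub_distrib]
  symm
  refine Finset.sum_of_injOn (fun l => 2 * l) ?_ ?_ ?_ ?_
  · intro a _ b _ hab
    simpa using hab
  · intro a ha
    simp at ha ⊢
    omega
  · intro m hm hm'
    simp only [Set.mem_image, Finset.coe_Icc, Set.mem_Icc, not_exists, not_and,
      Finset.mem_range] at hm hm'
    rcases Nat.even_or_odd' m with ⟨l, rfl | rfl⟩
    · have : l = 0 := by
        by_contra h
        exact hm' l ⟨by omega, by omega⟩ rfl
      subst this
      rw [walk_even, walk_even]
      simp only [binom]
      rw [if_neg (by push_cast; omega), if_neg (by push_cast; omega)]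
      simp
    · rw [walk_odd _ _ (by push_cast; omega), walk_odd _ _ (by push_cast; omega)]
      simp
  · intro l _
    rw [walk_even, walk_even, fNum, mul_sub]
    congr 2
    congr 1
    ring

theorem chebExp_eq (k r : ℕ) (hr : 1 ≤ r) :
    chebExp k r = (upCount r k 0 : ℤ) - upCount (r + 1) k 0 := by
  rw [upCount_zero_eq r k hr, upCount_zero_eq (r + 1) k (by omega), ← Finset.sum_sub_distrib]
  exact Finset.sum_congr rfl fun l _ => by rw [dNum]; ring

theorem upCount_last (k : ℕ) : upCount (k / 2 + 1) k 0 = 0 := by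
  have : (upCount (k / 2 + 1) k 0 : ℤ) = 0 := by
    rw [upCount_zero_eq _ k (by omega)]
    refine Finset.sum_eq_zero fun l hl => ?_
    rw [Finset.mem_Icc] at hl
    rw [fNum_eq_zero (by omega), mul_zero]
  exact_mod_cast this

/-- The Motzkin paths of length `k` from height `h` to height `0`. -/
def motzkinPaths : ℕ → ℕ → Finset (List (Fin 3))
  | 0, h => if h = 0 then {[]} else ∅
  | k + 1, h => Finset.univ.biUnion fun e : Fin 3 =>
      if 1 ≤ h + (e : ℕ) then (motzkinPaths k (h + e - 1)).image (List.cons e) else ∅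

theorem mem_motzkinPaths {k h : ℕ} {l : List (Fin 3)} :
    l ∈ motzkinPaths k h ↔ l.length = k ∧ IsMotzkin h l := by
  induction k generalizing h l with
  | zero =>
    simp only [motzkinPaths, List.length_eq_zero_iff]
    constructor
    · intro hl
      split_ifs at hl with h0
      · simp at hl
        subst hl
        exact ⟨rfl, h0⟩
      · simp at hl
    · rintro ⟨rfl, h0⟩
      rw [if_pos (show h = 0 from h0)]; simp
  | succ k ih =>
    simp only [motzkinPaths, Finset.mem_biUnion, Finset.mem_univ, true_and]
    constructor
    · rintro ⟨e, he⟩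
      split_ifs at he with h0
      · obtain ⟨l, hl, rfl⟩ := Finset.mem_image.1 he
        rw [ih] at hl
        exact ⟨by simp [hl.1], h0, hl.2⟩
      · simp at he
    · rintro ⟨hl, hm⟩
      rcases l with _ | ⟨e, l⟩
      · simp at hl
      · refine ⟨e, ?_⟩
        rw [if_pos hm.1, Finset.mem_image]
        exact ⟨l, ih.2 ⟨by simpa using hl, hm.2⟩, rfl⟩

@[to_additive]
theorem prod_motzkinPaths_succ {β : Type*} [CommMonoid β] (k h : ℕ) (f : List (Fin 3) → β) :
    ∏ l ∈ motzkinPaths (k + 1) h, f l =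
      ∏ e : Fin 3, if 1 ≤ h + (e : ℕ) then ∏ l ∈ motzkinPaths k (h + e - 1), f (e :: l) else 1 := by
  rw [motzkinPaths, Finset.prod_biUnion]
  · refine Finset.prod_congr rfl fun e _ => ?_
    split_ifs
    · rw [Finset.prod_image]
      intro a _ b _ hab
      simpa using hab
    · simp
  · intro a _ b _ hab
    rw [Function.onFun, Finset.disjoint_left]
    intro l hl hl'
    split_ifs at hl hl'
    · obtain ⟨x, _, rfl⟩ := Finset.mem_image.1 hl
      obtain ⟨y, _, hy⟩ := Finset.mem_image.1 hl'
      simp at hy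
      exact hab hy.1.symm
    all_goals simp at hl hl'

theorem card_motzkinPaths (k h : ℕ) : (motzkinPaths k h).card = pathCount k h := by
  induction k generalizing h with
  | zero => simp only [motzkinPaths, pathCount]; split_ifs <;> simp
  | succ k ih =>
    rw [Finset.card_eq_sum_ones, sum_motzkinPaths_succ, Fin.sum_univ_three]
    simp only [← Finset.card_eq_sum_ones, ih, pathCount]
    rcases h with _ | h <;> simp

theorem sum_count_motzkinPaths (k h : ℕ) :
    ∑ l ∈ motzkinPaths k h, l.count 1 = flatCount k h := by
  induction k generalizing h with
  | zero => simp only [motzkinPaths, flatCount]; split_ifs <;> simp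
  | succ k ih =>
    rw [sum_motzkinPaths_succ, Fin.sum_univ_three]
    simp only [List.count_cons, Finset.sum_add_distrib, ih, flatCount]
    rcases h with _ | h <;> simp [card_motzkinPaths] <;> ring

namespace DiagramModel

variable {K V E : Type} [CommRing K] [Fintype E] [DecidableEq E] {M : DiagramModel K V E}

theorem foldl_capAt {i : ℕ} {h g : V} {φ : List E → K} (hφ : ∀ l, φ l ≠ 0 → l.foldl M.act h = g)
    {l : List E} (hl : M.capAt i h φ l ≠ 0) : l.foldl M.act h = g := by
  induction i generalizing h φ l with
  | zero =>
    rcases l with _ | ⟨e, _ | ⟨e', l⟩⟩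
    · simp [capAt] at hl
    · simp [capAt] at hl
    · simp only [capAt, ne_eq, ite_eq_right_iff, not_forall] at hl
      obtain ⟨rfl, hl⟩ := hl
      have he : M.Ok h e := by
        by_contra he
        exact hl (by rw [M.c_ok h e he, zero_mul])
      rw [List.foldl_cons, List.foldl_cons, M.act_bar h e he]
      exact hφ l fun h0 => hl (by rw [h0, mul_zero])
  | succ i ih =>
    rcases l with _ | ⟨e, l⟩
    · simp [capAt] at hl
    · simp only [capAt] at hl
      exact ih (fun l hl => hφ (e :: l) hl) hl

theorem foldl_singleAt {i : ℕ} {h g : V} {φ : List E → K}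
    (hφ : ∀ l, φ l ≠ 0 → l.foldl M.act h = g)
    {l : List E} (hl : M.singleAt i h φ l ≠ 0) : l.foldl M.act h = g := by
  induction i generalizing h φ l with
  | zero =>
    rcases l with _ | ⟨e, l⟩
    · simp [singleAt] at hl
    · simp only [singleAt] at hl
      have he : M.act h e = h := by
        by_contra he
        exact hl (by rw [M.s_act h e he, zero_mul])
      rw [List.foldl_cons, he]
      exact hφ l fun h0 => hl (by rw [h0, mul_zero])
  | succ i ih =>
    rcases l with _ | ⟨e, l⟩
    · simp [singleAt] at hl
    · simp only [singleAt] at hl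
      exact ih (fun l hl => hφ (e :: l) hl) hl

/-- The vectors of diagrams are supported on closed paths. -/
theorem foldl_vec {v : List Op} {h : V} {l : List E} (hl : M.vec v h l ≠ 0) :
    l.foldl M.act h = h := by
  induction v generalizing l with
  | nil =>
    by_cases h0 : l = []
    · subst h0; rfl
    · simp [vec, h0] at hl
  | cons o v ih =>
    cases o with
    | cap i => exact foldl_capAt (fun l hl => ih hl) hl
    | single i => exact foldl_singleAt (fun l hl => ih hl) hl

theorem form_congr_left (m : ℕ) (h : V) {φ φ' : List E → K} (ψ : List E → K)
    (hφ : ∀ l, l.length = m → φ l = φ' l) : M.form m h φ ψ = M.form m h φ' ψ := by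
  induction m generalizing h φ φ' ψ with
  | zero => rw [form, form, hφ [] rfl]
  | succ m ih =>
    rw [form, form]
    refine Finset.sum_congr rfl fun e _ => ?_
    rw [ih _ _ fun l hl => hφ (e :: l) (by simp [hl])]

end DiagramModel

/-! ### The number of blocks -/

theorem colourModel_cupAt_one (i : ℕ) (l : List (Fin 2)) (hi : i ≤ l.length) :
    colourModel.cupAt i () (fun _ => 1) l = 2 := by
  induction i generalizing l with
  | zero => simp [DiagramModel.cupAt, DiagramModel.w, colourModel]
  | succ i ih =>
    rcases l with _ | ⟨e, l⟩
    · simp at hi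
    · exact ih l (by simpa using hi)

theorem colourModel_etaAt_one (i : ℕ) (l : List (Fin 2)) (hi : i ≤ l.length) :
    colourModel.etaAt i () (fun _ => 1) l = 2 := by
  induction i generalizing l with
  | zero => simp [DiagramModel.etaAt, DiagramModel.t, colourModel]
  | succ i ih =>
    rcases l with _ | ⟨e, l⟩
    · simp at hi
    · exact ih l (by simpa using hi)

theorem colourModel_form_one {v : List Op} (hv : OpsValid v) :
    colourModel.form (opsLength v) () (fun _ => 1) (colourModel.vec v ()) = 2 ^ v.length := by
  induction v with
  | nil => simp [opsLength, DiagramModel.form, DiagramModel.vec]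
  | cons o v ih =>
    cases o with
    | cap i =>
      rw [opsLength, DiagramModel.vec_cap, DiagramModel.form_capAt _ _ hv.1,
        DiagramModel.form_congr_left (φ' := fun l => 2 * 1), DiagramModel.form_mul_left, ih hv.2,
        List.length_cons, pow_succ']
      intro l hl
      rw [colourModel_cupAt_one i l (hl ▸ hv.1), mul_one]
    | single i =>
      rw [opsLength, DiagramModel.vec_single, DiagramModel.form_singleAt _ _ hv.1,
        DiagramModel.form_congr_left (φ' := fun l => 2 * 1), DiagramModel.form_mul_left, ih hv.2,
        List.length_cons, pow_succ']
      intro l hl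
      rw [colourModel_etaAt_one i l (hl ▸ hv.1), mul_one]

theorem count_opsPath (v : List Op) :
    (opsPath v).count 1 + opsLength v = 2 * v.length := by
  induction v with
  | nil => rfl
  | cons o v ih =>
    have h : ∀ i, ((opsPath v).take i).count 1 + ((opsPath v).drop i).count 1 =
        (opsPath v).count 1 := fun i => by
      rw [← List.count_append, List.take_append_drop]
    cases o with
    | cap i =>
      have := h i
      simp [opsPath, opsLength, List.count_append]
      omega
    | single i =>
      have := h i
      simp [opsPath, opsLength, List.count_append]
      omega

open Classical in
theorem form_eq_blockCount {k : ℕ} {π σ : Setoid (Fin k)} {φ ψ : List (Fin 2) → ℚ}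
    (hφ : ∀ l, l.length = k → φ l = if ConstOn (natRel π) l then 1 else 0)
    (hψ : ∀ l, l.length = k → ψ l = if ConstOn (natRel σ) l then 1 else 0) :
    colourModel.form k () φ ψ = 2 ^ blockCount (π ⊔ σ) := by
  rw [colourModel_form, ← sum_constOn]
  refine Finset.sum_congr rfl fun f _ => ?_
  rw [hφ _ (by simp), hψ _ (by simp)]

/-- Every partition into singletons and pairs is built by insertions, and the pairings of the
resulting vectors in any model are the entries of the Gram matrix. -/
theorem exists_ops_partition (k : ℕ) : ∃ v : FreeBistochasticPartition k → List Op,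
    (∀ π, OpsValid (v π)) ∧ (∀ π, opsLength (v π) = k) ∧
    (∀ π, opsPath (v π) = path k (natRel π.1)) ∧
    (∀ π, ((opsPath (v π)).count 1 : ℤ) = 2 * (blockCount π.1 : ℤ) - k) ∧
    ∀ {K V E : Type} [CommRing K] [Fintype E] [DecidableEq E] (M : DiagramModel K V E) (h : V),
      ∀ π σ, M.form k h (M.vec (v π) h) (M.vec (v σ) h) = M.n ^ blockCount (π.1 ⊔ σ.1) := by
  classical
  choose v hv hl hp hc using fun π : FreeBistochasticPartition k => (isDiag_natRel π).exists_ops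
  have hpow : ∀ a b : ℕ, (2 : ℚ) ^ a = 2 ^ b → a = b := fun a b h =>
    Nat.pow_right_injective (le_refl 2) (by exact_mod_cast h)
  refine ⟨v, hv, hl, hp, fun π => ?_, fun M h π σ => ?_⟩
  · have h1 := colourModel_form_one (hv π)
    rw [hl, form_eq_blockCount (π := ⊥) (σ := π.1) _ (hc π), bot_sup_eq] at h1
    · have := hpow _ _ h1
      have := count_opsPath (v π)
      rw [hl] at this
      omega
    · intro l _
      rw [if_pos]
      rintro a b ⟨ha, hb, hab⟩
      have : (⟨a, ha⟩ : Fin k) = ⟨b, hb⟩ := hab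
      rw [Fin.mk.inj_iff] at this
      rw [this]
  · obtain ⟨e, he⟩ := exists_form_vec (hv π) (hv σ) ((hl π).trans (hl σ).symm)
    rw [hl] at he
    have h1 := he colourModel ()
    rw [form_eq_blockCount (hc π) (hc σ)] at h1
    rw [he M h, hpow _ _ h1]

/-! ### The Motzkin path model -/

section Motzkin

variable {K : Type} [Field K] (n : K) (μ : ℕ → K)

/-- The model on the half line with vertices `ℕ`, steps `-1, 0, 1` and the weights `μ` of an
eigenvector of the adjacency matrix, for the loop parameter `n`. -/
def motzkinModel (hn : n ≠ 0) (hμ : ∀ r, μ r ≠ 0) (h0 : μ 0 = 1) (h1 : μ 1 = n - 1)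
    (hrec : ∀ r, μ (r + 2) = (n - 1) * μ (r + 1) - μ r) : DiagramModel K ℕ (Fin 3) where
  n := n
  act h e := h + e - 1
  bar := Fin.rev
  Ok h e := 1 ≤ h + (e : ℕ)
  s _ e := if e = 1 then 1 else 0
  c h e := ![if h = 0 then 0 else μ (h - 1) / μ h, n⁻¹, 1] e
  d h e := ![1, n, μ (h + 1) / μ h] e
  bar_bar e := Fin.rev_rev e
  act_bar h e he := by fin_cases e <;> simp at he ⊢; omega
  ok_bar h e he := by fin_cases e <;> simp at he ⊢
  c_ok h e he := by fin_cases e <;> simp at he ⊢; omega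
  s_ok h e he := by fin_cases e <;> simp at he ⊢
  s_act h e he := by fin_cases e <;> simp at he ⊢
  loop h := by
    rw [Fin.sum_univ_three]
    rcases h with _ | h
    · simp [Fin.rev, h0, h1]
      rw [mul_inv_cancel₀ hn]; ring
    · have := hμ h
      have := hμ (h + 1)
      simp [Fin.rev, hrec]
      field_simp
      ring
  zig h e he := by
    have := hμ h
    have := hμ (h + 1)
    fin_cases e
    · have := hμ (h - 1)
      simp at he
      have h2 : h - 1 + 1 = h := by omega
      have h3 : h ≠ 0 := by omega
      simp [Fin.rev, h2, h3]
      field_simp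
    · simp [Fin.rev]; field_simp
    · simp [Fin.rev]; field_simp
  s_loop h := by simp
  s_left h e := by fin_cases e <;> simp [Fin.rev]
  s_right h e := by fin_cases e <;> simp [Fin.rev]
  c_left h e := by fin_cases e <;> simp [Fin.rev, hn]
  c_right h e := by fin_cases e <;> simp [Fin.rev, hn]

variable {n μ} {hn : n ≠ 0} {hμ : ∀ r, μ r ≠ 0} {h0 : μ 0 = 1} {h1 : μ 1 = n - 1}
  {hrec : ∀ r, μ (r + 2) = (n - 1) * μ (r + 1) - μ r}

local notation "MM" => motzkinModel n μ hn hμ h0 h1 hrec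

theorem capAt_top {i : ℕ} {h : ℕ} {φ : List (Fin 3) → K} {x : List (Fin 3)} (hi : i ≤ x.length) :
    (MM).capAt i h φ (x.take i ++ 2 :: 0 :: x.drop i) = φ x := by
  induction i generalizing h φ x with
  | zero => simp [DiagramModel.capAt, motzkinModel]
  | succ i ih =>
    rcases x with _ | ⟨e, x⟩
    · simp at hi
    · simp only [List.take_succ_cons, List.drop_succ_cons, List.cons_append, DiagramModel.capAt]
      exact ih (φ := fun l => φ (e :: l)) (by simpa using hi)

theorem singleAt_top {i : ℕ} {h : ℕ} {φ : List (Fin 3) → K} {x : List (Fin 3)}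
    (hi : i ≤ x.length) :
    (MM).singleAt i h φ (x.take i ++ 1 :: x.drop i) = φ x := by
  induction i generalizing h φ x with
  | zero => simp [DiagramModel.singleAt, motzkinModel]
  | succ i ih =>
    rcases x with _ | ⟨e, x⟩
    · simp at hi
    · simp only [List.take_succ_cons, List.drop_succ_cons, List.cons_append, DiagramModel.singleAt]
      exact ih (φ := fun l => φ (e :: l)) (by simpa using hi)

theorem length_opsPath (v : List Op) (hv : OpsValid v) : (opsPath v).length = opsLength v := by
  induction v with
  | nil => rfl
  | cons o v ih =>
    cases o with
    | cap i =>
      have := ih hv.2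
      have := hv.1
      simp [opsPath, opsLength]; omega
    | single i =>
      have := ih hv.2
      have := hv.1
      simp [opsPath, opsLength]; omega

theorem vec_opsPath {v : List Op} (hv : OpsValid v) (h : ℕ) : (MM).vec v h (opsPath v) = 1 := by
  induction v with
  | nil => simp [DiagramModel.vec, opsPath]
  | cons o v ih =>
    cases o with
    | cap i =>
      rw [DiagramModel.vec_cap, opsPath, capAt_top, ih hv.2]
      rw [length_opsPath v hv.2]; exact hv.1
    | single i =>
      rw [DiagramModel.vec_single, opsPath, singleAt_top, ih hv.2]
      rw [length_opsPath v hv.2]; exact hv.1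

theorem cons_le_cons_iff_lex {α : Type} [LinearOrder α] {a b : α} {l m : List α} :
    a :: l ≤ b :: m ↔ a < b ∨ a = b ∧ l ≤ m := by
  rw [le_iff_lt_or_eq, le_iff_lt_or_eq, List.cons_lt_cons_iff, List.cons.injEq]
  tauto

theorem le_of_capAt_ne_zero {i h : ℕ} {φ : List (Fin 3) → K} {x y : List (Fin 3)}
    (hi : i ≤ x.length) (hφ : ∀ y, φ y ≠ 0 → y ≤ x) (hy : (MM).capAt i h φ y ≠ 0) :
    y ≤ x.take i ++ 2 :: 0 :: x.drop i := by
  induction i generalizing h φ x y with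
  | zero =>
    rcases y with _ | ⟨e, _ | ⟨e', y⟩⟩
    · simp [DiagramModel.capAt] at hy
    · simp [DiagramModel.capAt] at hy
    · simp only [DiagramModel.capAt, ne_eq, ite_eq_right_iff, not_forall] at hy
      obtain ⟨rfl, hy⟩ := hy
      have hyx := hφ y fun h0 => hy (by rw [h0, mul_zero])
      simp only [List.take_zero, List.nil_append, List.drop_zero, cons_le_cons_iff_lex]
      rcases (show e < 2 ∨ e = 2 by have := e.2; rw [Fin.lt_def, Fin.ext_iff]; simp; omega)
        with h | rfl
      · exact Or.inl h
      · exact Or.inr ⟨rfl, Or.inr ⟨rfl, hyx⟩⟩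
  | succ i ih =>
    rcases x with _ | ⟨a, x⟩
    · simp at hi
    rcases y with _ | ⟨e, y⟩
    · simp [DiagramModel.capAt] at hy
    simp only [DiagramModel.capAt] at hy
    simp only [List.take_succ_cons, List.drop_succ_cons, List.cons_append, cons_le_cons_iff_lex]
    rcases lt_trichotomy e a with hlt | rfl | hgt
    · exact Or.inl hlt
    · refine Or.inr ⟨rfl, ih (by simpa using hi) (fun z hz => ?_) hy⟩
      simpa [cons_le_cons_iff_lex] using hφ _ hz
    · exfalso
      have : (fun l => φ (e :: l)) = fun l => 0 * φ (e :: l) := by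
        funext l
        rw [zero_mul]
        by_contra hne
        have := hφ _ hne
        rw [cons_le_cons_iff_lex] at this
        rcases this with h | h
        · exact absurd hgt (not_lt.2 h.le)
        · exact absurd h.1 hgt.ne'
      rw [this, DiagramModel.capAt_mul, zero_mul] at hy
      exact hy rfl

theorem le_of_singleAt_ne_zero {i h : ℕ} {φ : List (Fin 3) → K} {x y : List (Fin 3)}
    (hi : i ≤ x.length) (hφ : ∀ y, φ y ≠ 0 → y ≤ x) (hy : (MM).singleAt i h φ y ≠ 0) :
    y ≤ x.take i ++ 1 :: x.drop i := by
  induction i generalizing h φ x y with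
  | zero =>
    rcases y with _ | ⟨e, y⟩
    · simp [DiagramModel.singleAt] at hy
    · simp only [DiagramModel.singleAt] at hy
      have hyx := hφ y fun h0 => hy (by rw [h0, mul_zero])
      have he : e = 1 := by
        by_contra he
        exact hy (by simp [motzkinModel, he])
      simp only [List.take_zero, List.nil_append, List.drop_zero, cons_le_cons_iff_lex]
      exact Or.inr ⟨he, hyx⟩
  | succ i ih =>
    rcases x with _ | ⟨a, x⟩
    · simp at hi
    rcases y with _ | ⟨e, y⟩
    · simp [DiagramModel.singleAt] at hy
    simp only [DiagramModel.singleAt] at hy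
    simp only [List.take_succ_cons, List.drop_succ_cons, List.cons_append, cons_le_cons_iff_lex]
    rcases lt_trichotomy e a with hlt | rfl | hgt
    · exact Or.inl hlt
    · refine Or.inr ⟨rfl, ih (by simpa using hi) (fun z hz => ?_) hy⟩
      simpa [cons_le_cons_iff_lex] using hφ _ hz
    · exfalso
      have : (fun l => φ (e :: l)) = fun l => 0 * φ (e :: l) := by
        funext l
        rw [zero_mul]
        by_contra hne
        have := hφ _ hne
        rw [cons_le_cons_iff_lex] at this
        rcases this with h | h
        · exact absurd hgt (not_lt.2 h.le)
        · exact absurd h.1 hgt.ne'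
      rw [this, DiagramModel.singleAt_mul, zero_mul] at hy
      exact hy rfl

theorem le_of_vec_ne_zero {v : List Op} (hv : OpsValid v) {h : ℕ} {y : List (Fin 3)}
    (hy : (MM).vec v h y ≠ 0) : y ≤ opsPath v := by
  induction v generalizing y with
  | nil =>
    by_cases hy0 : y = []
    · subst hy0; exact le_refl _
    · simp [DiagramModel.vec, hy0] at hy
  | cons o v ih =>
    cases o with
    | cap i =>
      exact le_of_capAt_ne_zero (by rw [length_opsPath v hv.2]; exact hv.1)
        (fun y hy => ih hv.2 hy) hy
    | single i =>
      exact le_of_singleAt_ne_zero (by rw [length_opsPath v hv.2]; exact hv.1)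
        (fun y hy => ih hv.2 hy) hy

theorem isMotzkin_iff {h : ℕ} {l : List (Fin 3)} :
    IsMotzkin h l ↔ (MM).OkPath h l ∧ l.foldl (MM).act h = 0 := by
  induction l generalizing h with
  | nil => simp [IsMotzkin, DiagramModel.OkPath]
  | cons e l ih =>
    rw [IsMotzkin, DiagramModel.OkPath, List.foldl_cons, and_assoc, ← ih]
    rfl

theorem mem_motzkinPaths_of_vec_ne_zero {v : List Op} (hv : OpsValid v) {y : List (Fin 3)}
    (hy : (MM).vec v 0 y ≠ 0) : y ∈ motzkinPaths (opsLength v) 0 := by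
  rw [mem_motzkinPaths, isMotzkin_iff (hn := hn) (hμ := hμ) (h0 := h0) (h1 := h1) (hrec := hrec)]
  have := DiagramModel.supp_vec hv 0 y hy
  exact ⟨this.1, this.2, DiagramModel.foldl_vec hy⟩

/-- The weight of a Motzkin path in the bilinear form. -/
def pathWeight (n : K) (μ : ℕ → K) : ℕ → List (Fin 3) → K
  | _, [] => 1
  | h, e :: l => ![1, n, μ (h + 1) / μ h] e * pathWeight n μ (h + e - 1) l

theorem form_eq_sum (k h : ℕ) (φ ψ : List (Fin 3) → K) (hφ : ∀ l, φ l ≠ 0 → IsMotzkin h l) :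
    (MM).form k h φ ψ = ∑ l ∈ motzkinPaths k h, pathWeight n μ h l * φ l * ψ l := by
  induction k generalizing h φ ψ with
  | zero =>
    rw [DiagramModel.form, motzkinPaths]
    split_ifs with hh
    · simp [pathWeight]
    · have : φ [] = 0 := by
        by_contra hne
        exact hh (hφ _ hne)
      simp [this]
  | succ k ih =>
    rw [DiagramModel.form, sum_motzkinPaths_succ]
    refine Finset.sum_congr rfl fun e _ => ?_
    split_ifs with he
    · rw [show (MM).act h e = h + e - 1 from rfl, ih _ _ _ fun l hl =>
        (show 1 ≤ h + (e : ℕ) ∧ IsMotzkin (h + e - 1) l from hφ (e :: l) hl).2, Finset.mul_sum]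
      refine Finset.sum_congr rfl fun l _ => ?_
      rw [pathWeight, show (MM).d h e = ![1, n, μ (h + 1) / μ h] e from rfl]
      ring
    · have : (fun l => φ (e :: l)) = fun l => 0 * φ (e :: l) := by
        funext l
        rw [zero_mul]
        by_contra hne
        exact he (hφ _ hne).1
      rw [this, DiagramModel.form_mul_left, zero_mul, mul_zero]

end Motzkin

/-- The bijection between diagrams and Motzkin paths. -/
noncomputable def partitionEquiv (k : ℕ) (hm : ∀ π : FreeBistochasticPartition k,
    path k (natRel π.1) ∈ motzkinPaths k 0) : FreeBistochasticPartition k ≃ motzkinPaths k 0 :=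
  Equiv.ofBijective (fun π => ⟨path k (natRel π.1), hm π⟩) (by
    constructor
    · intro π σ h
      exact path_injective (congrArg Subtype.val h)
    · rintro ⟨x, hx⟩
      obtain ⟨hlen, hx'⟩ := mem_motzkinPaths.1 hx
      subst hlen
      obtain ⟨π, hπ⟩ := (isDiag_motzkinRel x).exists_partition
      refine ⟨π, Subtype.ext ?_⟩
      simp only [hπ, path_motzkinRel hx'])

theorem det_gramMatrix {K : Type} [Field K] (k : ℕ) (n : K) (μ : ℕ → K) (hn : n ≠ 0)
    (hμ : ∀ r, μ r ≠ 0) (h0 : μ 0 = 1) (h1 : μ 1 = n - 1)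
    (hrec : ∀ r, μ (r + 2) = (n - 1) * μ (r + 1) - μ r) :
    (gramMatrix k n).det = ∏ l ∈ motzkinPaths k 0, pathWeight n μ 0 l ∧
      aExp k = ∑ l ∈ motzkinPaths k 0, (l.count 1 : ℤ) := by
  obtain ⟨v, hv, hl, hp, hc, hM⟩ := exists_ops_partition k
  let M := motzkinModel n μ hn hμ h0 h1 hrec
  have hmem : ∀ π l, M.vec (v π) 0 l ≠ 0 → l ∈ motzkinPaths k 0 := fun π l h => by
    rw [← hl π]; exact mem_motzkinPaths_of_vec_ne_zero (hv π) h
  have hm : ∀ π : FreeBistochasticPartition k, path k (natRel π.1) ∈ motzkinPaths k 0 := by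
    intro π
    refine hmem π _ ?_
    rw [← hp π, vec_opsPath (hv π)]
    exact one_ne_zero
  let e := partitionEquiv k hm
  have he : ∀ x, opsPath (v (e.symm x)) = x := by
    intro x
    rw [hp]
    exact congrArg Subtype.val (e.apply_symm_apply x)
  constructor
  · let W : Matrix (motzkinPaths k 0) (motzkinPaths k 0) K :=
      Matrix.of fun x y => M.vec (v (e.symm x)) 0 y
    have hW : W.det = 1 := by
      rw [Matrix.det_of_isLowerTriangular]
      · refine Finset.prod_eq_one fun x _ => ?_
        have := vec_opsPath (hn := hn) (hμ := hμ) (h0 := h0) (h1 := h1) (hrec := hrec)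
          (hv (e.symm x)) 0
        rwa [he] at this
      · intro x y hxy
        by_contra hne
        have := le_of_vec_ne_zero (hv (e.symm x)) hne
        rw [he] at this
        exact absurd hxy (not_lt.2 this)
    have hG : (gramMatrix k n).submatrix e.symm e.symm =
        W * Matrix.diagonal (fun x : motzkinPaths k 0 => pathWeight n μ 0 x) * W.transpose := by
      ext x y
      rw [Matrix.mul_apply]
      simp only [Matrix.mul_diagonal, Matrix.transpose_apply, Matrix.submatrix_apply, gramMatrix,
        Matrix.of_apply, W]
      refine (hM M 0 _ _).symm.trans ?_
      rw [form_eq_sum, ← Finset.sum_coe_sort]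
      · exact Finset.sum_congr rfl fun z _ => by ring
      · exact fun l hl => (mem_motzkinPaths.1 (hmem _ _ hl)).2
    rw [← Matrix.det_submatrix_equiv_self e.symm, hG, Matrix.det_mul, Matrix.det_mul,
      Matrix.det_transpose, hW, Matrix.det_diagonal, one_mul, mul_one, Finset.prod_coe_sort]
  · refine Eq.trans ?_ (Finset.sum_coe_sort (motzkinPaths k 0) fun l => (l.count 1 : ℤ))
    refine Fintype.sum_equiv e _ _ fun π => ?_
    rw [← he, e.symm_apply_apply, hc]

theorem prod_pathWeight {K : Type} [Field K] (n : K) (μ : ℕ → K) (R k h : ℕ)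
    (hR : h + k ≤ 2 * R + 1) : ∏ l ∈ motzkinPaths k h, pathWeight n μ h l =
      n ^ flatCount k h * ∏ r ∈ Finset.Icc 1 R, (μ r / μ (r - 1)) ^ upCount r k h := by
  induction k generalizing h with
  | zero =>
    simp only [motzkinPaths, flatCount, upCount, pow_zero, Finset.prod_const_one, mul_one]
    split_ifs <;> simp [pathWeight]
  | succ k ih =>
    have hup : ∏ r ∈ Finset.Icc 1 R, (μ r / μ (r - 1)) ^
        (if h + 1 = r then pathCount k (h + 1) else 0) =
          (μ (h + 1) / μ h) ^ pathCount k (h + 1) := by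
      by_cases hh : h + 1 ≤ R
      · rw [Finset.prod_eq_single (h + 1)]
        · simp
        · intro r _ hr
          rw [if_neg (Ne.symm hr), pow_zero]
        · intro hr
          exact absurd (Finset.mem_Icc.2 ⟨by omega, hh⟩) hr
      · rw [pathCount_eq_zero (by omega)]
        simp
    rw [prod_motzkinPaths_succ, Fin.prod_univ_three]
    simp only [pathWeight, Finset.prod_mul_distrib, Finset.prod_const, card_motzkinPaths,
      flatCount, upCount, pow_add, hup]
    rcases h with _ | h
    · simp only [Fin.val_zero, Fin.val_one, Fin.val_two]
      simp [ih 0 (by omega), ih 1 (by omega)]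
      ring
    · have e0 : h + 1 + 0 - 1 = h := by omega
      have e1 : h + 1 + 1 - 1 = h + 1 := by omega
      have e2 : h + 1 + 2 - 1 = h + 1 + 1 := by omega
      simp only [Fin.val_zero, Fin.val_one, Fin.val_two, e0, e1, e2]
      rw [ih h (by omega), ih (h + 1) (by omega), ih (h + 1 + 1) (by omega)]
      simp
      ring

theorem prod_div_pow {K : Type} [Field K] (μ : ℕ → K) (hμ : ∀ r, μ r ≠ 0) (h0 : μ 0 = 1)
    (a : ℕ → ℕ) (R : ℕ) : ∏ r ∈ Finset.Icc 1 R, (μ r / μ (r - 1)) ^ a r =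
      (∏ r ∈ Finset.Icc 1 R, μ r ^ ((a r : ℤ) - a (r + 1))) * μ R ^ a (R + 1) := by
  induction R with
  | zero => simp [h0]
  | succ R ih =>
    rw [Finset.prod_Icc_succ_top (by omega), ih, Finset.prod_Icc_succ_top (by omega),
      Nat.add_sub_cancel, zpow_sub₀ (hμ _), zpow_natCast, zpow_natCast, div_pow]
    have := hμ R
    have := hμ (R + 1)
    field_simp

theorem aExp_eq_flatCount (k : ℕ) (h : aExp k = ∑ l ∈ motzkinPaths k 0, (l.count 1 : ℤ)) :
    aExp k = flatCount k 0 := by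
  rw [h, ← sum_count_motzkinPaths]
  push_cast
  rfl

theorem map_chebyshevP {R S : Type*} [CommRing R] [CommRing S] (f : R →+* S) (r : ℕ) (x : R) :
    f (chebyshevP r x) = chebyshevP r (f x) := by
  rw [chebyshevP, chebyshevP, ← Chebyshev.map_S f, eval_map, eval₂_at_apply]

theorem map_gramMatrix_det {R S : Type*} [CommRing R] [CommRing S] (f : R →+* S) (k : ℕ) (x : R) :
    f (gramMatrix k x).det = (gramMatrix k (f x)).det := by
  rw [RingHom.map_det]
  congr 1
  ext π σ
  simp [gramMatrix]

theorem chebyshevP_polynomial_ne_zero (r : ℕ) : chebyshevP r (X - 1 : ℚ[X]) ≠ 0 := by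
  intro h
  have h1 := map_chebyshevP (evalRingHom (3 : ℚ)) r (X - 1)
  rw [h, map_zero, map_sub, map_one, coe_evalRingHom, eval_X, show (3 : ℚ) - 1 = 2 by norm_num,
    chebyshevP, Chebyshev.S_eval_two] at h1
  have : (0 : ℚ) < (r : ℤ) + 1 := by positivity
  exact this.ne h1

theorem chebyshevP_ratFunc (r : ℕ) : chebyshevP r ((RatFunc.X : RatFunc ℚ) - 1) =
    algebraMap ℚ[X] (RatFunc ℚ) (chebyshevP r (X - 1)) := by
  rw [map_chebyshevP, map_sub, map_one, RatFunc.algebraMap_X]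

theorem chebyshevP_ratFunc_ne_zero (r : ℕ) : chebyshevP r ((RatFunc.X : RatFunc ℚ) - 1) ≠ 0 := by
  rw [chebyshevP_ratFunc]
  exact RatFunc.algebraMap_ne_zero (chebyshevP_polynomial_ne_zero r)

theorem det_gramMatrix_ratFunc (k : ℕ) :
    ((gramMatrix k (RatFunc.X : RatFunc ℚ)).det = RatFunc.X ^ aExp k *
      ∏ r ∈ Finset.Icc 1 (k / 2), chebyshevP r ((RatFunc.X : RatFunc ℚ) - 1) ^ chebExp k r) ∧
    aExp k = flatCount k 0 := by
  have h0 : chebyshevP 0 ((RatFunc.X : RatFunc ℚ) - 1) = 1 := by simp [chebyshevP]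
  obtain ⟨hdet, ha⟩ := det_gramMatrix k (RatFunc.X : RatFunc ℚ)
    (fun r => chebyshevP r (RatFunc.X - 1)) RatFunc.X_ne_zero chebyshevP_ratFunc_ne_zero h0
    (by simp [chebyshevP]) (fun r => by
      simp only [chebyshevP]
      push_cast
      rw [Chebyshev.S_add_two]
      simp)
  have ha' := aExp_eq_flatCount k ha
  refine ⟨?_, ha'⟩
  rw [hdet, prod_pathWeight _ _ (k / 2) _ _ (by omega),
    prod_div_pow _ chebyshevP_ratFunc_ne_zero h0 (fun r => upCount r k 0), upCount_last, pow_zero,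
    mul_one, ha', zpow_natCast]
  congr 1
  refine Finset.prod_congr rfl fun r hr => ?_
  rw [chebExp_eq k r (Finset.mem_Icc.1 hr).1]

/-- The determinant identity with the negative powers cleared. -/
theorem det_gramMatrix_mul (k : ℕ) {R : Type*} [CommRing R] [Algebra ℚ R] (n : R) :
    (gramMatrix k n).det *
        ∏ r ∈ Finset.Icc 1 (k / 2), chebyshevP r (n - 1) ^ (-chebExp k r).toNat =
      n ^ flatCount k 0 *
        ∏ r ∈ Finset.Icc 1 (k / 2), chebyshevP r (n - 1) ^ (chebExp k r).toNat := by
  have key : (gramMatrix k (X : ℚ[X])).det *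
        ∏ r ∈ Finset.Icc 1 (k / 2), chebyshevP r (X - 1 : ℚ[X]) ^ (-chebExp k r).toNat =
      X ^ flatCount k 0 *
        ∏ r ∈ Finset.Icc 1 (k / 2), chebyshevP r (X - 1 : ℚ[X]) ^ (chebExp k r).toNat := by
    apply RatFunc.algebraMap_injective ℚ
    simp only [map_mul, map_prod, map_pow, ← chebyshevP_ratFunc, map_gramMatrix_det,
      RatFunc.algebraMap_X]
    obtain ⟨hdet, ha⟩ := det_gramMatrix_ratFunc k
    rw [hdet, ha, zpow_natCast, mul_assoc, ← Finset.prod_mul_distrib]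
    congr 1
    refine Finset.prod_congr rfl fun r _ => ?_
    rw [← zpow_natCast, ← zpow_natCast, ← zpow_add₀ (chebyshevP_ratFunc_ne_zero r)]
    congr 1
    omega
  have := congrArg (aeval n).toRingHom key
  simp only [map_mul, map_prod, map_pow, map_chebyshevP, map_gramMatrix_det, map_sub,
    map_one] at this
  simpa using this

end BistochasticGram

theorem theorem5p2 (k : ℕ) :
    -- the identity in the field of rational functions in the indeterminate `n = RatFunc.X`
    ((BistochasticGram.gramMatrix k (RatFunc.X : RatFunc ℚ)).det =
      (RatFunc.X : RatFunc ℚ) ^ BistochasticGram.aExp k *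
        ∏ r ∈ Finset.Icc 1 (k / 2),
          BistochasticGram.chebyshevP r ((RatFunc.X : RatFunc ℚ) - 1) ^
            BistochasticGram.chebExp k r) ∧
    -- the identity at every number `n` where no zero is raised to a negative power
    (∀ n : ℝ,
      (∀ r ∈ Finset.Icc 1 (k / 2), BistochasticGram.chebExp k r < 0 →
        BistochasticGram.chebyshevP r (n - 1) ≠ 0) →
      (BistochasticGram.gramMatrix k n).det =
        n ^ BistochasticGram.aExp k *
          ∏ r ∈ Finset.Icc 1 (k / 2),
            BistochasticGram.chebyshevP r (n - 1) ^ BistochasticGram.chebExp k r) := by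
  refine ⟨(BistochasticGram.det_gramMatrix_ratFunc k).1, fun n hn => ?_⟩
  have h := BistochasticGram.det_gramMatrix_mul k n
  have hne : ∏ r ∈ Finset.Icc 1 (k / 2),
      BistochasticGram.chebyshevP r (n - 1) ^ (-BistochasticGram.chebExp k r).toNat ≠ 0 := by
    refine Finset.prod_ne_zero_iff.2 fun r hr => ?_
    by_cases hneg : BistochasticGram.chebExp k r < 0
    · exact pow_ne_zero _ (hn r hr hneg)
    · rw [show (-BistochasticGram.chebExp k r).toNat = 0 by omega, pow_zero]
      exact one_ne_zero
  refine mul_right_cancel₀ hne (h.trans ?_)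
  rw [(BistochasticGram.det_gramMatrix_ratFunc k).2, zpow_natCast, mul_assoc,
    ← Finset.prod_mul_distrib]
  congr 1
  refine Finset.prod_congr rfl fun r hr => ?_
  by_cases hneg : BistochasticGram.chebExp k r < 0
  · rw [← zpow_natCast, ← zpow_natCast, ← zpow_add₀ (hn r hr hneg)]
    congr 1
    omega
  · rw [show (-BistochasticGram.chebExp k r).toNat = 0 by omega, pow_zero, mul_one,
      ← zpow_natCast, Int.toNat_of_nonneg (not_lt.1 hneg)]
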